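/- For integers $n \ge k \ge 1$ let $H(n,k)$ be the set of all integers $t$ such that $t = |S \cap \{0,1\}^n|$ for some $k$-dimensional linear subspace $S$ of $\mathbb{R}^n$, and let $H^+(n,k) = H(n,k) \setminus \{1, \dots, 2^{k-1}\}$. For every integer $k \ge 6$, \begin{align*} H^+(k+1,k) &= \left\{ 2^{k-1} + 2^{k-5} + 2^{k-6},\ 2^{k-1} + 2^{k-3},\ 2^{k-1} + 2^{k-2},\ 2^{k} \right\},\\ H^+(k+2,k) &= H^+(k+1,k) \cup \{ 2^{k-1} + 2^{k-4} \},\\ H^+(k+i,k) &= H^+(k+i-1,k) \cup \{ 2^{k-1} + 2^{k-(i+1)} \} \quad \text{for } i = 3, \dots, k-1,\\ H^+(k+i,k) &= H^+(2k-1,k) \quad \text{for all } i \ge k. \end{align*} -/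

import Mathlib

/-- The vertex set `{0, 1}ⁿ` of the `n`-dimensional hypercube in `ℝⁿ`. -/
def hypercube (n : ℕ) : Set (Fin n → ℝ) :=
  {x | ∀ i, x i = 0 ∨ x i = 1}

/-- `H(n, k)`: the set of all possible sizes of the intersection of the hypercube `{0, 1}ⁿ` with a
`k`-dimensional linear subspace of `ℝⁿ`. -/
def intersectionSizes (n k : ℕ) : Set ℕ :=
  {t | ∃ S : Submodule ℝ (Fin n → ℝ), Module.finrank ℝ S = k ∧
    t = Set.ncard ((S : Set (Fin n → ℝ)) ∩ hypercube n)}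

/-- `H⁺(n, k) = H(n, k) \ {1, …, 2 ^ (k - 1)}`: the large intersection sizes. -/
def largeIntersectionSizes (n k : ℕ) : Set ℕ :=
  intersectionSizes n k \ Set.Icc 1 (2 ^ (k - 1))

/-! A `k`-dimensional subspace is parametrized by `k` of its own coordinates, so its cube vertices
are the `y` in `{0,1}^k` at which each of the other `n - k` coordinates, a linear functional `a` of
`y`, is `0` or `1`. With `y = (1 + z) / 2` this condition reads `|2 a y - 1| = 1`, and an extra sign
in front of the constant term turns `2 a y - 1` into a linear functional of `k + 1` signs. Hence the
size is `2 ^ k * P`, where `P` is the probability that `n - k` functionals all take values `±1` at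
uniform signs (`ncard_inter_hypercube`). The task is to find all `P > 1/2`.

A single functional with `P > 1/2` is a signed sum of 1, 3, 5 or 7 signs, with `P` equal to 1, 3/4,
5/8 or 35/64 (`exists_isSigned_of_half_lt`); one sign is no condition at all. Two functionals of
length 5 or 7, different up to sign, already give at most 1/2 (`signProb_hits_and_hits_le_of_card`).
So as soon as two different conditions are present, one of them is a sum of three signs, `f = e ±
s_j` with `e` a signed pair. With probability 1/2 the pair `e` vanishes, and there `f` hits
automatically; otherwise `|e| = 2`, and `f` hits half of the time. Studying a second functional on
these two pieces (`IsSigned.cases_of_card_eq_three`) leaves two large configurations: a sunflower,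
whose petals are `e ± s_j` with a common `e`, and a pair of probability 9/16.

A sunflower with `i` petals has probability `1/2 + 1/2^(i+1)`, and any further functional is
redundant, a new petal, or fatal (`IsSunflower.extend`). A third condition added to a 9/16 pair is
fatal or forms a sunflower with `f` (`IsTriple.Splits.signProb_le`). Conversely every value is
realized once `k ≥ 6`. Since `k + 1` signs leave room for at most `k - 1` petals, the list of sizes
stabilizes. -/

/-! ### Uniform probabilities on sign vectors -/

set_option linter.unusedSectionVars false

section SignVectors

/-- The real number `±1` given by a unit of `ℤ`. -/
def signVal (u : ℤˣ) : ℝ := ((u : ℤ) : ℝ)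

theorem signVal_eq (u : ℤˣ) : signVal u = 1 ∨ signVal u = -1 := by
  rcases Int.units_eq_one_or u with rfl | rfl <;> simp [signVal]

theorem signVal_neg (u : ℤˣ) : signVal (-u) = -signVal u := by simp [signVal]

theorem abs_signVal (u : ℤˣ) : |signVal u| = 1 := by
  rcases signVal_eq u with h | h <;> simp [h]

/-- Negate the coordinate `i` of a sign vector. -/
def flipSign {ι : Type*} [DecidableEq ι] (i : ι) : (ι → ℤˣ) ≃ (ι → ℤˣ) where
  toFun s := Function.update s i (-s i)
  invFun s := Function.update s i (-s i)
  left_inv s := by simp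
  right_inv s := by simp

theorem flipSign_apply {ι : Type*} [DecidableEq ι] (i j : ι) (s : ι → ℤˣ) :
    flipSign i s j = if j = i then -s i else s j := by
  simp [flipSign, Function.update_apply]

variable {ι : Type*} [Fintype ι] [DecidableEq ι]

open Classical in
/-- The probability of an event under the uniform distribution on sign vectors. -/
noncomputable def signProb (Q : (ι → ℤˣ) → Prop) : ℝ :=
  (∑ s, if Q s then (1 : ℝ) else 0) / 2 ^ Fintype.card ι

/-- The value of the linear functional with coefficients `a` at a sign vector. -/
def signDot (a : ι → ℝ) (s : ι → ℤˣ) : ℝ := ∑ i, a i * signVal (s i)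

/-- The linear functional `a` takes the value `1` or `-1` at `s`. -/
def Hits (a : ι → ℝ) (s : ι → ℤˣ) : Prop := |signDot a s| = 1

theorem signDot_add (a b : ι → ℝ) (s : ι → ℤˣ) :
    signDot (a + b) s = signDot a s + signDot b s := by
  simp [signDot, add_mul, Finset.sum_add_distrib]

theorem signDot_sub (a b : ι → ℝ) (s : ι → ℤˣ) :
    signDot (a - b) s = signDot a s - signDot b s := by
  simp [signDot, sub_mul, Finset.sum_sub_distrib]

theorem signDot_neg (a : ι → ℝ) (s : ι → ℤˣ) : signDot (-a) s = -signDot a s := by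
  simp [signDot]

theorem signDot_smul (c : ℝ) (a : ι → ℝ) (s : ι → ℤˣ) :
    signDot (c • a) s = c * signDot a s := by
  simp [signDot, Finset.mul_sum, mul_assoc]

theorem signDot_single (i : ι) (c : ℝ) (s : ι → ℤˣ) :
    signDot (Pi.single i c) s = c * signVal (s i) := by
  rw [signDot, Finset.sum_eq_single i]
  · simp
  · intro j _ hj; simp [hj]
  · simp

theorem signDot_flipSign (a : ι → ℝ) (i : ι) (s : ι → ℤˣ) :
    signDot a (flipSign i s) = signDot a s - 2 * (a i * signVal (s i)) := by
  have h : ∀ j, a j * signVal (flipSign i s j) =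
      a j * signVal (s j) - (if j = i then 2 * (a i * signVal (s i)) else 0) := by
    intro j
    rw [flipSign_apply]
    split_ifs with hj
    · subst hj; rw [signVal_neg]; ring
    · ring
  simp only [signDot, h, Finset.sum_sub_distrib]
  simp

theorem hits_neg (a : ι → ℝ) (s : ι → ℤˣ) : Hits (-a) s ↔ Hits a s := by
  simp [Hits, signDot_neg]

theorem hits_congr {a b : ι → ℝ} {s : ι → ℤˣ} (h : signDot a s = signDot b s) :
    Hits a s ↔ Hits b s := by
  simp [Hits, h]

theorem hits_flipSign {a : ι → ℝ} {i : ι} (h : a i = 0) (s : ι → ℤˣ) :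
    Hits a (flipSign i s) ↔ Hits a s := by
  simp [Hits, signDot_flipSign, h]

theorem signProb_congr {Q R : (ι → ℤˣ) → Prop} (h : ∀ s, Q s ↔ R s) :
    signProb Q = signProb R := by
  rw [show Q = R from funext fun s => propext (h s)]

theorem signProb_mono {Q R : (ι → ℤˣ) → Prop} (h : ∀ s, Q s → R s) :
    signProb Q ≤ signProb R := by
  unfold signProb
  gcongr with s
  split_ifs with h1 h2 <;> simp_all

theorem signProb_of_forall {Q : (ι → ℤˣ) → Prop} (h : ∀ s, Q s) : signProb Q = 1 := by
  unfold signProb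
  simp [h]

theorem signProb_of_forall_not {Q : (ι → ℤˣ) → Prop} (h : ∀ s, ¬ Q s) : signProb Q = 0 := by
  unfold signProb
  simp [h]

theorem signProb_comp_equiv (e : (ι → ℤˣ) ≃ (ι → ℤˣ)) (Q : (ι → ℤˣ) → Prop) :
    signProb (fun s => Q (e s)) = signProb Q := by
  classical
  unfold signProb
  congr 1
  exact Equiv.sum_comp e (fun s => if Q s then (1 : ℝ) else 0)

theorem signProb_or {Q R : (ι → ℤˣ) → Prop} (h : ∀ s, Q s → ¬ R s) :
    signProb (fun s => Q s ∨ R s) = signProb Q + signProb R := by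
  unfold signProb
  rw [← add_div, ← Finset.sum_add_distrib]
  congr 1
  refine Finset.sum_congr rfl fun s _ => ?_
  by_cases h1 : Q s <;> by_cases h2 : R s <;> simp_all

theorem signProb_split (R Q : (ι → ℤˣ) → Prop) :
    signProb Q = signProb (fun s => R s ∧ Q s) + signProb (fun s => ¬ R s ∧ Q s) := by
  rw [← signProb_or (fun s h1 h2 => h2.1 h1.1)]
  exact signProb_congr fun s => by tauto

/-- If flipping a coordinate preserves `Q` and, on `Q`, negates `R`, then `R` holds on half of
`Q`. -/
theorem signProb_and_of_flip {Q R : (ι → ℤˣ) → Prop} (i : ι)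
    (hQ : ∀ s, Q (flipSign i s) ↔ Q s) (hR : ∀ s, Q s → (R (flipSign i s) ↔ ¬ R s)) :
    signProb (fun s => R s ∧ Q s) = 1 / 2 * signProb Q := by
  have h1 := signProb_split R Q
  have h2 : signProb (fun s => ¬ R s ∧ Q s) = signProb (fun s => R s ∧ Q s) := by
    rw [← signProb_comp_equiv (flipSign i) (fun s => R s ∧ Q s)]
    refine signProb_congr fun s => ?_
    rw [hQ]
    constructor
    · rintro ⟨a, b⟩; exact ⟨(hR s b).2 a, b⟩
    · rintro ⟨a, b⟩; exact ⟨(hR s b).1 a, b⟩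
  linarith

open Classical in
/-- Averaging over the orbits of two coordinate flips. -/
theorem four_mul_signProb_le {Q R : (ι → ℤˣ) → Prop} (i j : ι) (r : ℝ)
    (h : ∀ s, (if Q s then (1 : ℝ) else 0) + (if Q (flipSign i s) then 1 else 0) +
      (if Q (flipSign j s) then 1 else 0) + (if Q (flipSign i (flipSign j s)) then 1 else 0) ≤
      r * (if R s then 1 else 0)) :
    4 * signProb Q ≤ r * signProb R := by
  have h1 := signProb_comp_equiv (flipSign i) Q
  have h2 := signProb_comp_equiv (flipSign j) Q
  have h3 := signProb_comp_equiv ((flipSign j).trans (flipSign i)) Q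
  have h4 : signProb Q + signProb (fun s => Q (flipSign i s)) +
      signProb (fun s => Q (flipSign j s)) +
      signProb (fun s => Q (((flipSign j).trans (flipSign i)) s)) ≤ r * signProb R := by
    unfold signProb
    rw [← add_div, ← add_div, ← add_div, ← mul_div_assoc, ← Finset.sum_add_distrib,
      ← Finset.sum_add_distrib, ← Finset.sum_add_distrib, Finset.mul_sum]
    gcongr with s
    exact h s
  linarith

/-- The coefficients of `a` are `±1` on `T` and vanish off `T`. -/
def IsSigned (a : ι → ℝ) (T : Finset ι) : Prop :=
  (∀ i ∈ T, |a i| = 1) ∧ ∀ i, i ∉ T → a i = 0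

theorem IsSigned.neg {a : ι → ℝ} {T : Finset ι} (h : IsSigned a T) : IsSigned (-a) T :=
  ⟨fun i hi => by simpa using h.1 i hi, fun i hi => by simpa using h.2 i hi⟩

theorem IsSigned.signDot_eq {a : ι → ℝ} {T : Finset ι} (h : IsSigned a T) (s : ι → ℤˣ) :
    signDot a s = ∑ i ∈ T, a i * signVal (s i) := by
  rw [signDot, ← Finset.sum_subset (Finset.subset_univ T)]
  intro i _ hi
  simp [h.2 i hi]

theorem abs_mul_signVal (x : ℝ) (u : ℤˣ) : |x * signVal u| = |x| := by
  rw [abs_mul, abs_signVal, mul_one]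

theorem IsSigned.hits_of_singleton {a : ι → ℝ} {i : ι} (h : IsSigned a {i}) (s : ι → ℤˣ) :
    Hits a s := by
  rw [Hits, h.signDot_eq, Finset.sum_singleton, abs_mul_signVal]
  exact h.1 i (by simp)

open Classical in
theorem ite_add_le_two {A B C D : Prop} (h1 : ¬ (A ∧ B ∧ C)) (h2 : ¬ (A ∧ B ∧ D)) (h3 : ¬ (A ∧ C ∧ D)) (h4 : ¬ (B ∧ C ∧ D)) :
    (if A then (1 : ℝ) else 0) + (if B then 1 else 0) + (if C then 1 else 0) +
      (if D then 1 else 0) ≤ 2 := by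
  split_ifs <;> first | (exfalso; tauto) | norm_num

open Classical in
theorem ite_add_le_three {A B C D : Prop} (h : ¬ (A ∧ B ∧ C ∧ D)) :
    (if A then (1 : ℝ) else 0) + (if B then 1 else 0) + (if C then 1 else 0) +
      (if D then 1 else 0) ≤ 3 := by
  split_ifs <;> first | (exfalso; tauto) | norm_num

/-- Functionals with two nonzero coefficients of different absolute values hit with probability at
most `1 / 2`. -/
theorem signProb_hits_le_of_abs_ne {a : ι → ℝ} {i j : ι} (hi : a i ≠ 0) (hj : a j ≠ 0)
    (hij : |a i| ≠ |a j|) : signProb (Hits a) ≤ 1 / 2 := by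
  have hne : i ≠ j := by rintro rfl; exact hij rfl
  have key := four_mul_signProb_le (Q := Hits a) (R := fun _ => True) i j 2 ?_
  · rw [signProb_of_forall (Q := fun _ : ι → ℤˣ => True) (fun _ => trivial)] at key
    linarith
  intro s
  have hx : |a i * signVal (s i)| ≠ |a j * signVal (s j)| := by
    rwa [abs_mul_signVal, abs_mul_signVal]
  have hx0 : a i * signVal (s i) ≠ 0 := by
    rw [← abs_pos, abs_mul_signVal]; exact abs_pos.2 hi
  have hy0 : a j * signVal (s j) ≠ 0 := by
    rw [← abs_pos, abs_mul_signVal]; exact abs_pos.2 hj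
  rw [if_pos trivial, mul_one]
  have e1 := signDot_flipSign a i s
  have e2 := signDot_flipSign a j s
  have e3 : signDot a (flipSign i (flipSign j s)) =
      signDot a s - 2 * (a j * signVal (s j)) - 2 * (a i * signVal (s i)) := by
    rw [signDot_flipSign, signDot_flipSign, flipSign_apply, if_neg hne]
  -- The four values on the flip orbit, `d`, `d - 2x`, `d - 2y` and `d - 2x - 2y`, are pairwise
  -- different because `x, y ≠ 0` and `x ≠ ±y`; only two of them can be `±1`.
  have three : ∀ {u v w : ℝ}, u ≠ v → v ≠ w → u ≠ w → ¬ (|u| = 1 ∧ |v| = 1 ∧ |w| = 1) := by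
    rintro u v w h1 h2 h3 ⟨h4, h5, h6⟩
    rcases eq_or_eq_neg_of_abs_eq h4 with rfl | rfl <;>
    rcases eq_or_eq_neg_of_abs_eq h5 with rfl | rfl <;>
    rcases eq_or_eq_neg_of_abs_eq h6 with rfl | rfl <;> simp_all
  refine ite_add_le_two ?_ ?_ ?_ ?_ <;> simp only [Hits, e1, e2, e3] <;>
    generalize signDot a s = d <;>
    generalize a i * signVal (s i) = x at * <;>
    generalize a j * signVal (s j) = y at * <;>
    have hxy1 : x ≠ y := (fun h => hx (by rw [h])) <;>
    have hxy2 : x ≠ -y := (fun h => hx (by rw [h, abs_neg])) <;>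
    apply three <;> intro h <;>
    first
      | exact hx0 (by linarith)
      | exact hy0 (by linarith)
      | exact hxy1 (by linarith)
      | exact hxy2 (by linarith)

/-- The linear functional `a ≠ 0` vanishes with probability at most `1 / 2`. -/
theorem signProb_signDot_eq_zero_le {a : ι → ℝ} (ha : a ≠ 0) :
    signProb (fun s => signDot a s = 0) ≤ 1 / 2 := by
  obtain ⟨i, hi⟩ := Function.ne_iff.1 ha
  have h := signProb_split (fun s => signDot a s = 0) (fun _ : ι → ℤˣ => True)
  rw [signProb_of_forall (Q := fun _ : ι → ℤˣ => True) (fun _ => trivial)] at h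
  have h2 : signProb (fun s => signDot a s = 0) ≤ signProb (fun s => ¬ signDot a s = 0 ∧ True) := by
    rw [← signProb_comp_equiv (flipSign i) (fun s => ¬ signDot a s = 0 ∧ True)]
    refine signProb_mono fun s hs => ⟨?_, trivial⟩
    rw [signDot_flipSign, hs]
    have : a i * signVal (s i) ≠ 0 := by
      rw [← abs_pos, abs_mul_signVal]; exact abs_pos.2 hi
    intro h; apply this; linarith
  simp only [and_true] at h h2
  linarith

/-- The distribution of a sum of independent signs. -/
theorem signProb_sum_eq {a : ι → ℝ} (C : Finset ι) (hC : ∀ i ∈ C, |a i| = 1) (j : ℕ) :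
    signProb (fun s => ∑ i ∈ C, a i * signVal (s i) = (C.card : ℝ) - 2 * j) =
      (C.card.choose j : ℝ) / 2 ^ C.card := by
  induction C using Finset.induction_on generalizing j with
  | empty =>
    rcases j with _ | j
    · rw [signProb_of_forall] <;> simp
    · rw [signProb_of_forall_not]
      · simp
      · intro s; simp; positivity
  | insert i C hi ih =>
    have hC' : ∀ i ∈ C, |a i| = 1 := fun k hk => hC k (Finset.mem_insert_of_mem hk)
    have hai : |a i| = 1 := hC i (Finset.mem_insert_self _ _)
    have hinv : ∀ s, ∑ k ∈ C, a k * signVal (flipSign i s k) = ∑ k ∈ C, a k * signVal (s k) := by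
      intro s
      refine Finset.sum_congr rfl fun k hk => ?_
      rw [flipSign_apply, if_neg (by rintro rfl; exact hi hk)]
    have hflip : ∀ s, a i * signVal (flipSign i s i) = - (a i * signVal (s i)) := by
      intro s; rw [flipSign_apply, if_pos rfl, signVal_neg]; ring
    have hcase : ∀ s : ι → ℤˣ, a i * signVal (s i) = 1 ∨ a i * signVal (s i) = -1 := fun s =>
      eq_or_eq_neg_of_abs_eq (by rw [abs_mul_signVal, hai])
    -- Here `j` counts the negative terms. Conditioning on the sign of the new term gives Pascal's
    -- recursion.
    rw [signProb_split (fun s => a i * signVal (s i) = 1)]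
    have h1 : signProb (fun s => a i * signVal (s i) = 1 ∧
        ∑ k ∈ insert i C, a k * signVal (s k) = ((insert i C).card : ℝ) - 2 * j) =
        1 / 2 * signProb (fun s => ∑ k ∈ C, a k * signVal (s k) = (C.card : ℝ) - 2 * j) := by
      rw [← signProb_and_of_flip (R := fun s => a i * signVal (s i) = 1) i]
      · refine signProb_congr fun s => and_congr_right fun hs => ?_
        rw [Finset.sum_insert hi, Finset.card_insert_of_notMem hi, hs]
        push_cast
        constructor <;> intro h <;> linarith
      · intro s; rw [hinv]
      · intro s _
        rw [hflip]
        rcases hcase s with h | h <;> rw [h] <;> norm_num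
    have h2 : signProb (fun s => ¬ a i * signVal (s i) = 1 ∧
        ∑ k ∈ insert i C, a k * signVal (s k) = ((insert i C).card : ℝ) - 2 * j) =
        1 / 2 * signProb (fun s => ∑ k ∈ C, a k * signVal (s k) = (C.card : ℝ) - 2 * (j - 1)) := by
      rw [← signProb_and_of_flip (R := fun s => ¬ a i * signVal (s i) = 1) i]
      · refine signProb_congr fun s => and_congr_right fun hs => ?_
        rw [Finset.sum_insert hi, Finset.card_insert_of_notMem hi, (hcase s).resolve_left hs]
        push_cast
        constructor <;> intro h <;> linarith
      · intro s; rw [hinv]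
      · intro s _
        rw [hflip]
        rcases hcase s with h | h <;> rw [h] <;> norm_num
    rw [h1, h2, Finset.card_insert_of_notMem hi, ih hC']
    rcases j with _ | j
    -- The index `j - 1` is real, so for `j = 0` the second term asks for the value `C.card + 2`,
    -- which is out of range.
    · have : signProb (fun s => ∑ k ∈ C, a k * signVal (s k) =
          (C.card : ℝ) - 2 * (((0 : ℕ) : ℝ) - 1)) = 0 := by
        refine signProb_of_forall_not fun s hs => ?_
        have hle : ∑ k ∈ C, a k * signVal (s k) ≤ ∑ k ∈ C, (1 : ℝ) :=
          Finset.sum_le_sum fun k hk => by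
            have := le_abs_self (a k * signVal (s k))
            rwa [abs_mul_signVal, hC' k hk] at this
        simp at hle hs
        linarith
      rw [this, pow_succ]
      simp
    · have := ih hC' j
      push_cast
      rw [add_sub_cancel_right, this, Nat.choose_succ_succ, pow_succ]
      push_cast
      field_simp
      ring

theorem exists_sum_eq {a : ι → ℝ} (C : Finset ι) (hC : ∀ i ∈ C, |a i| = 1) (s : ι → ℤˣ) :
    ∃ j : ℕ, j ≤ C.card ∧ ∑ i ∈ C, a i * signVal (s i) = (C.card : ℝ) - 2 * j := by
  induction C using Finset.induction_on with
  | empty => exact ⟨0, by simp⟩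
  | insert i C hi ih =>
    obtain ⟨j, hj, h⟩ := ih fun k hk => hC k (Finset.mem_insert_of_mem hk)
    rw [Finset.sum_insert hi, Finset.card_insert_of_notMem hi, h]
    rcases eq_or_eq_neg_of_abs_eq
      ((abs_mul_signVal (a i) (s i)).trans (hC i (Finset.mem_insert_self _ _))) with h1 | h1
    · exact ⟨j, by omega, by rw [h1]; push_cast; ring⟩
    · exact ⟨j + 1, by omega, by rw [h1]; push_cast; ring⟩

/-- The values `1` and `-1` correspond to `r` and `r + 1` negative terms, which are equally likely.
-/
theorem IsSigned.signProb_hits_of_odd {a : ι → ℝ} {T : Finset ι} (h : IsSigned a T) {r : ℕ}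
    (hr : T.card = 2 * r + 1) :
    signProb (Hits a) = ((2 * r + 1).choose r : ℝ) / 4 ^ r := by
  have h1 : ∀ s, Hits a s ↔ (∑ i ∈ T, a i * signVal (s i) = (T.card : ℝ) - 2 * (r : ℕ)) ∨
      (∑ i ∈ T, a i * signVal (s i) = (T.card : ℝ) - 2 * (r + 1 : ℕ)) := by
    intro s
    rw [Hits, h.signDot_eq, abs_eq zero_le_one, hr]
    push_cast
    refine or_congr ?_ ?_ <;> constructor <;> intro h <;> linarith
  rw [signProb_congr h1, signProb_or, signProb_sum_eq T h.1, signProb_sum_eq T h.1, hr,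
    ← Nat.choose_symm_half r, pow_succ, pow_mul]
  · norm_num; field_simp; ring
  · intro s h2 h3
    rw [h2] at h3
    push_cast at h3
    linarith

theorem IsSigned.signProb_hits_of_even {a : ι → ℝ} {T : Finset ι} (h : IsSigned a T)
    (hr : Even T.card) : signProb (Hits a) = 0 := by
  refine signProb_of_forall_not fun s hs => ?_
  obtain ⟨j, -, hj⟩ := exists_sum_eq T h.1 s
  obtain ⟨m, hm⟩ := hr
  rw [Hits, h.signDot_eq, hj, hm, abs_eq zero_le_one] at hs
  rcases hs with hs | hs
  · have : ((m : ℤ) + m - 2 * j) = 1 := by exact_mod_cast hs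
    omega
  · have : ((m : ℤ) + m - 2 * j) = -1 := by exact_mod_cast hs
    omega

/-- This cuts off sums of nine or more signs. The base case is `252 ≤ 256`; by Pascal's rule, used
twice, the binomial coefficient grows by a factor of at most 4 in each step. -/
theorem two_mul_choose_le {r : ℕ} (hr : 4 ≤ r) : 2 * (2 * r + 1).choose r ≤ 4 ^ r := by
  induction r, hr using Nat.le_induction with
  | base => decide
  | succ r hr ih =>
    have h1 : (2 * r + 1 + 1).choose r ≤ (2 * r + 1 + 1).choose (r + 1) :=
      Nat.choose_le_succ_of_lt_half_left (by omega)
    have h2 := Nat.choose_succ_succ (2 * r + 1) r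
    have h3 := Nat.choose_succ_succ (2 * r + 1 + 1) r
    have h4 := Nat.choose_symm_half r
    rw [show 2 * (r + 1) + 1 = (2 * r + 1 + 1).succ by omega, h3, pow_succ]
    simp only [Nat.succ_eq_add_one] at *
    omega

/-- Functionals that hit with probability more than `1 / 2` have few nonzero coefficients, all of
them `±1`. -/
theorem exists_isSigned_of_half_lt {a : ι → ℝ} (h : 1 / 2 < signProb (Hits a)) :
    ∃ T, IsSigned a T ∧ (T.card = 1 ∨ T.card = 3 ∨ T.card = 5 ∨ T.card = 7) := by
  set T := Finset.univ.filter fun i => a i ≠ 0 with hT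
  have hT0 : ∀ i, i ∉ T → a i = 0 := by intro i; simp [hT]
  have hT1 : ∀ i ∈ T, a i ≠ 0 := by intro i; simp [hT]
  have hunit : ∀ i ∈ T, |a i| = 1 := by
    intro i hi
    by_contra hne
    have hall : ∀ j ∈ T, |a j| = |a i| := by
      intro j hj
      by_contra h'
      exact absurd (signProb_hits_le_of_abs_ne (hT1 j hj) (hT1 i hi) h') (by linarith)
    -- Flipping `i` moves the value by `2 |a i|`, which is neither 0 nor 2, so it never leads from
    -- `±1` to `±1`: hits are mapped injectively to misses.
    have key : signProb (Hits a) ≤ signProb (fun s => ¬ Hits a s ∧ True) := by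
      rw [← signProb_comp_equiv (flipSign i) (fun s => ¬ Hits a s ∧ True)]
      refine signProb_mono fun s hs => ⟨?_, trivial⟩
      rw [Hits, signDot_flipSign]
      rw [Hits] at hs
      intro h2
      have h3 : |a i * signVal (s i)| ≠ 1 := by rwa [abs_mul_signVal]
      have h4 : a i * signVal (s i) ≠ 0 := by
        rw [← abs_pos, abs_mul_signVal]; exact abs_pos.2 (hT1 i hi)
      generalize a i * signVal (s i) = x at *
      generalize signDot a s = d at *
      rcases eq_or_eq_neg_of_abs_eq hs with rfl | rfl <;>
        rcases eq_or_eq_neg_of_abs_eq h2 with h5 | h5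
      · exact h4 (by linarith)
      · exact h3 (by rw [show x = 1 by linarith]; simp)
      · exact h3 (by rw [show x = -1 by linarith]; simp)
      · exact h4 (by linarith)
    have h5 := signProb_split (Hits a) (fun _ => True)
    rw [signProb_of_forall (Q := fun _ : ι → ℤˣ => True) (fun _ => trivial)] at h5
    simp only [and_true] at h5 key
    linarith
  have hs : IsSigned a T := ⟨hunit, hT0⟩
  refine ⟨T, hs, ?_⟩
  rcases Nat.even_or_odd T.card with he | ⟨r, hr⟩
  · rw [hs.signProb_hits_of_even he] at h; norm_num at h
  · by_cases hr4 : 4 ≤ r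
    · rw [hs.signProb_hits_of_odd hr, lt_div_iff₀ (by positivity)] at h
      have : (2 * (2 * r + 1).choose r : ℝ) ≤ 4 ^ r := by exact_mod_cast two_mul_choose_le hr4
      linarith
    · omega

theorem IsSigned.signProb_hits_three {a : ι → ℝ} {T : Finset ι} (h : IsSigned a T)
    (hT : T.card = 3) : signProb (Hits a) = 3 / 4 := by
  rw [h.signProb_hits_of_odd (r := 1) (by omega)]; norm_num

theorem IsSigned.signProb_hits_five {a : ι → ℝ} {T : Finset ι} (h : IsSigned a T)
    (hT : T.card = 5) : signProb (Hits a) = 5 / 8 := by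
  rw [h.signProb_hits_of_odd (r := 2) (by omega), show Nat.choose (2 * 2 + 1) 2 = 10 by decide]
  norm_num

theorem IsSigned.signProb_hits_seven {a : ι → ℝ} {T : Finset ι} (h : IsSigned a T)
    (hT : T.card = 7) : signProb (Hits a) = 35 / 64 := by
  rw [h.signProb_hits_of_odd (r := 3) (by omega), show Nat.choose (2 * 3 + 1) 3 = 35 by decide]
  norm_num

end SignVectors

/-! ### Two functionals with at least five nonzero coefficients -/

section Pairs

variable {ι : Type*} [Fintype ι] [DecidableEq ι]

theorem mul_signVal_eq {x : ℝ} (hx : |x| = 1) (u : ℤˣ) :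
    x * signVal u = 1 ∨ x * signVal u = -1 :=
  eq_or_eq_neg_of_abs_eq (by rw [abs_mul_signVal, hx])

/-- Two functionals whose relative sign is different at two common coordinates. -/
theorem signProb_hits_and_hits_le_of_mul_ne {f g : ι → ℝ} {l m : ι}
    (hfl : |f l| = 1) (hfm : |f m| = 1) (hgl : |g l| = 1) (hgm : |g m| = 1)
    (h : f l * g l ≠ f m * g m) : signProb (fun s => Hits f s ∧ Hits g s) ≤ 1 / 2 := by
  have hne : l ≠ m := by rintro rfl; exact h rfl
  have key := four_mul_signProb_le (Q := fun s => Hits f s ∧ Hits g s) (R := fun _ => True) l m 2 ?_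
  · rw [signProb_of_forall (Q := fun _ : ι → ℤˣ => True) (fun _ => trivial)] at key
    linarith
  intro s
  rw [if_pos trivial, mul_one]
  have e3 : ∀ a : ι → ℝ, signDot a (flipSign l (flipSign m s)) =
      signDot a s - 2 * (a m * signVal (s m)) - 2 * (a l * signVal (s l)) := by
    intro a
    rw [signDot_flipSign, signDot_flipSign, flipSign_apply, if_neg hne]
  have hrel : f l * signVal (s l) * (g l * signVal (s l)) ≠
      f m * signVal (s m) * (g m * signVal (s m)) := by
    have sq : ∀ u : ℤˣ, signVal u * signVal u = 1 := fun u => by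
      rw [← abs_mul_abs_self, abs_signVal, one_mul]
    rwa [mul_mul_mul_comm, sq, mul_one, mul_mul_mul_comm, sq, mul_one]
  -- The relative signs differ, so exactly one of `f`, `g` has equal contributions from `l` and `m`.
  -- Flipping both coordinates moves that one by 4; the other one differs by 4 between the two
  -- single flips. Values in `±1` cannot differ by 4, so the orbit splits into two pairs with at
  -- most one joint hit each.
  have hAD : ¬ ((Hits f s ∧ Hits g s) ∧
      (Hits f (flipSign l (flipSign m s)) ∧ Hits g (flipSign l (flipSign m s)))) := by
    rintro ⟨⟨h1, h2⟩, h3, h4⟩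
    rw [Hits, e3] at h3 h4
    have b1 := abs_le.1 (le_of_eq h1)
    have b2 := abs_le.1 (le_of_eq h2)
    have b3 := abs_le.1 (le_of_eq h3)
    have b4 := abs_le.1 (le_of_eq h4)
    rcases mul_signVal_eq hfl (s l) with h5 | h5 <;>
    rcases mul_signVal_eq hfm (s m) with h6 | h6 <;>
    rcases mul_signVal_eq hgl (s l) with h7 | h7 <;>
    rcases mul_signVal_eq hgm (s m) with h8 | h8 <;>
    rw [h5, h6, h7, h8] at hrel <;> first | linarith | norm_num at hrel
  have hBC : ¬ ((Hits f (flipSign l s) ∧ Hits g (flipSign l s)) ∧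
      (Hits f (flipSign m s) ∧ Hits g (flipSign m s))) := by
    rintro ⟨⟨h1, h2⟩, h3, h4⟩
    rw [Hits, signDot_flipSign] at h1 h2 h3 h4
    have b1 := abs_le.1 (le_of_eq h1)
    have b2 := abs_le.1 (le_of_eq h2)
    have b3 := abs_le.1 (le_of_eq h3)
    have b4 := abs_le.1 (le_of_eq h4)
    rcases mul_signVal_eq hfl (s l) with h5 | h5 <;>
    rcases mul_signVal_eq hfm (s m) with h6 | h6 <;>
    rcases mul_signVal_eq hgl (s l) with h7 | h7 <;>
    rcases mul_signVal_eq hgm (s m) with h8 | h8 <;>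
    rw [h5, h6, h7, h8] at hrel <;> first | linarith | norm_num at hrel
  apply ite_add_le_two <;> tauto

/-- A functional with two coefficients `±1` at coordinates on which `Q` does not depend. -/
theorem signProb_and_hits_le_of_flip {Q : (ι → ℤˣ) → Prop} {g : ι → ℝ} {i j : ι} (hij : i ≠ j)
    (hi : ∀ s, Q (flipSign i s) ↔ Q s) (hj : ∀ s, Q (flipSign j s) ↔ Q s)
    (hgi : |g i| = 1) (hgj : |g j| = 1) :
    signProb (fun s => Q s ∧ Hits g s) ≤ 3 / 4 * signProb Q := by
  have key := four_mul_signProb_le (Q := fun s => Q s ∧ Hits g s) (R := Q) i j 3 ?_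
  · linarith
  intro s
  by_cases hQ : Q s
  swap
  · simp [hi, hj, hQ]
  have e3 : signDot g (flipSign i (flipSign j s)) =
      signDot g s - 2 * (g j * signVal (s j)) - 2 * (g i * signVal (s i)) := by
    rw [signDot_flipSign, signDot_flipSign, flipSign_apply, if_neg hij]
  -- Two of the four values on the orbit differ by 4: the first and last if the contributions of `i`
  -- and `j` agree, the middle two if they are opposite.
  have hno : ¬ (Hits g s ∧ Hits g (flipSign i s) ∧ Hits g (flipSign j s) ∧
      Hits g (flipSign i (flipSign j s))) := by
    rintro ⟨h1, h2, h3, h4⟩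
    rw [Hits, e3] at h4
    rw [Hits, signDot_flipSign] at h2 h3
    have b1 := abs_le.1 (le_of_eq h1)
    have b2 := abs_le.1 (le_of_eq h2)
    have b3 := abs_le.1 (le_of_eq h3)
    have b4 := abs_le.1 (le_of_eq h4)
    rcases mul_signVal_eq hgi (s i) with h5 | h5 <;>
      rcases mul_signVal_eq hgj (s j) with h6 | h6 <;> linarith
  rw [if_pos hQ, mul_one]
  apply ite_add_le_three
  tauto

/-- Two functionals that agree except for one coordinate each. -/
theorem signProb_hits_and_hits_le_of_insert {f g : ι → ℝ} {C : Finset ι} {i j : ι} (hij : i ≠ j)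
    (hi : i ∉ C) (hj : j ∉ C) (hf : IsSigned f (insert i C)) (hg : IsSigned g (insert j C))
    (hfg : ∀ l ∈ C, f l = g l) (hC : C.card = 4 ∨ C.card = 6) :
    signProb (fun s => Hits f s ∧ Hits g s) ≤ 1 / 2 := by
  set c : (ι → ℤˣ) → ℝ := fun s => ∑ l ∈ C, f l * signVal (s l) with hc
  have hfC : ∀ l ∈ C, |f l| = 1 := fun l hl => hf.1 l (Finset.mem_insert_of_mem hl)
  have hfi : |f i| = 1 := hf.1 i (Finset.mem_insert_self _ _)
  have hgj : |g j| = 1 := hg.1 j (Finset.mem_insert_self _ _)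
  have hdf : ∀ s, signDot f s = f i * signVal (s i) + c s := fun s => by
    rw [hf.signDot_eq, Finset.sum_insert hi]
  have hdg : ∀ s, signDot g s = g j * signVal (s j) + c s := fun s => by
    rw [hg.signDot_eq, Finset.sum_insert hj, hc]
    congr 1
    exact Finset.sum_congr rfl fun l hl => by rw [hfg l hl]
  have hflip : ∀ k, k ∉ C → ∀ s, c (flipSign k s) = c s := by
    intro k hk s
    refine Finset.sum_congr rfl fun l hl => ?_
    rw [flipSign_apply, if_neg (by rintro rfl; exact hk hl)]
  have hflip' : ∀ (a : ι → ℝ) (k : ι) (s : ι → ℤˣ), a k * signVal (flipSign k s k) =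
      -(a k * signVal (s k)) := fun a k s => by
    rw [flipSign_apply, if_pos rfl, signVal_neg]; ring
  have hQ : signProb (fun s => g j * signVal (s j) = -(c s) / 2 ∧
      (f i * signVal (s i) = -(c s) / 2 ∧ |c s| = 2)) = 1 / 4 * signProb (fun s => |c s| = 2) := by
    rw [signProb_and_of_flip j, signProb_and_of_flip i]
    · ring
    · intro s; rw [hflip i hi]
    · intro s hs
      rw [hflip i hi, hflip']
      rcases eq_or_eq_neg_of_abs_eq hs with h | h <;>
        rcases mul_signVal_eq hfi (s i) with h' | h' <;> rw [h, h'] <;> norm_num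
    · intro s; rw [hflip j hj, flipSign_apply, if_neg hij]
    · rintro s ⟨-, hs⟩
      rw [hflip j hj, hflip']
      rcases eq_or_eq_neg_of_abs_eq hs with h | h <;>
        rcases mul_signVal_eq hgj (s j) with h' | h' <;> rw [h, h'] <;> norm_num
  -- With `c` the common part, an even sum, both functionals hit exactly if `c = 0`, or if `|c| = 2`
  -- and both extra signs oppose `c`.
  have hle : signProb (fun s => Hits f s ∧ Hits g s) ≤
      signProb (fun s => c s = 0) + 1 / 4 * signProb (fun s => |c s| = 2) := by
    rw [← hQ, ← signProb_or]
    · refine signProb_mono fun s hs => ?_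
      rw [Hits, Hits, hdf, hdg] at hs
      obtain ⟨m, -, hm⟩ := exists_sum_eq C hfC s
      rcases eq_or_eq_neg_of_abs_eq hs.1 with h1 | h1 <;>
        rcases eq_or_eq_neg_of_abs_eq hs.2 with h2 | h2 <;>
        rcases mul_signVal_eq hfi (s i) with h3 | h3 <;>
        rcases mul_signVal_eq hgj (s j) with h4 | h4 <;> rw [h3] at h1 ⊢ <;> rw [h4] at h2 ⊢ <;>
        first
          | (exfalso; linarith)
          | (left; linarith)
          | (right; rw [show c s = 2 by linarith]; norm_num)
          | (right; rw [show c s = -2 by linarith]; norm_num)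
    · rintro s hs ⟨-, -, h⟩
      rw [hs] at h; norm_num at h
  have h2 : signProb (fun s => |c s| = 2) =
      signProb (fun s => c s = 2) + signProb (fun s => c s = -2) := by
    rw [← signProb_or (fun s h1 h2 => by rw [h1] at h2; norm_num at h2)]
    exact signProb_congr fun s => abs_eq (by norm_num)
  have hd := signProb_sum_eq C hfC
  rw [h2] at hle
  -- The bound is `6/16 + 1/4 * 8/16 = 1/2` for four common signs and `20/64 + 1/4 * 30/64 = 55/128`
  -- for six.
  rcases hC with hC | hC <;> rw [hC] at hd
  · have h0 := hd 2
    have h1 := hd 1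
    have h3 := hd 3
    rw [show Nat.choose 4 2 = 6 by decide] at h0
    rw [show Nat.choose 4 1 = 4 by decide] at h1
    rw [show Nat.choose 4 3 = 4 by decide] at h3
    norm_num at h0 h1 h3
    rw [h0, h1, h3] at hle
    linarith
  · have h0 := hd 3
    have h1 := hd 2
    have h3 := hd 4
    rw [show Nat.choose 6 3 = 20 by decide] at h0
    rw [show Nat.choose 6 2 = 15 by decide] at h1
    rw [show Nat.choose 6 4 = 15 by decide] at h3
    norm_num at h0 h1 h3
    rw [h0, h1, h3] at hle
    linarith

theorem IsSigned.hits_flipSign {a : ι → ℝ} {T : Finset ι} (h : IsSigned a T) {i : ι} (hi : i ∉ T)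
    (s : ι → ℤˣ) : Hits a (flipSign i s) ↔ Hits a s :=
  _root_.hits_flipSign (h.2 i hi) s

/-- If one support has two coordinates outside the other, the bound is `3/4 * 5/8 < 1/2`. Otherwise
the supports have equal size and are equal or differ in one coordinate each. A relative sign that
varies on the overlap is fatal; if it is constant, replacing `g` by `-g` makes the functionals agree
on the overlap, so that they coincide or share all but one sign each. -/
theorem signProb_hits_and_hits_le_of_card {f g : ι → ℝ} {A B : Finset ι}
    (hf : IsSigned f A) (hg : IsSigned g B) (hA : A.card = 5 ∨ A.card = 7)
    (hB : B.card = 5 ∨ B.card = 7) (h1 : f ≠ g) (h2 : f ≠ -g) :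
    signProb (fun s => Hits f s ∧ Hits g s) ≤ 1 / 2 := by
  have aux : ∀ {f g : ι → ℝ} {A B : Finset ι}, IsSigned f A → IsSigned g B →
      (A.card = 5 ∨ A.card = 7) → 1 < (B \ A).card →
      signProb (fun s => Hits f s ∧ Hits g s) ≤ 1 / 2 := by
    intro f g A B hf hg hA h
    obtain ⟨i, hi, j, hj, hij⟩ := Finset.one_lt_card.1 h
    rw [Finset.mem_sdiff] at hi hj
    have := signProb_and_hits_le_of_flip hij (hf.hits_flipSign hi.2) (hf.hits_flipSign hj.2)
      (hg.1 i hi.1) (hg.1 j hj.1)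
    rcases hA with hA | hA
    · rw [hf.signProb_hits_five hA] at this; linarith
    · rw [hf.signProb_hits_seven hA] at this; linarith
  by_cases hBA : 1 < (B \ A).card
  · exact aux hf hg hA hBA
  by_cases hAB : 1 < (A \ B).card
  · rw [signProb_congr fun s => and_comm]
    exact aux hg hf hB hAB
  have cA := Finset.card_sdiff_add_card_inter A B
  have cB := Finset.card_sdiff_add_card_inter B A
  rw [Finset.inter_comm] at cB
  have hne : (A ∩ B).Nonempty := by
    rw [← Finset.card_pos]; omega
  obtain ⟨l, hl⟩ := hne
  have hl' := Finset.mem_inter.1 hl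
  by_cases hmul : ∀ m ∈ A ∩ B, f m * g m = f l * g l
  swap
  · push Not at hmul
    obtain ⟨m, hm, hne⟩ := hmul
    have hm' := Finset.mem_inter.1 hm
    exact signProb_hits_and_hits_le_of_mul_ne (hf.1 m hm'.1) (hf.1 l hl'.1) (hg.1 m hm'.2)
      (hg.1 l hl'.2) hne
  have main : ∀ {g : ι → ℝ}, IsSigned g B → f ≠ g → (∀ m ∈ A ∩ B, f m = g m) →
      signProb (fun s => Hits f s ∧ Hits g s) ≤ 1 / 2 := by
    intro g hg hfg hag
    by_cases h0 : (A \ B).card = 0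
    · exfalso
      have h0' : (B \ A).card = 0 := by omega
      rw [Finset.card_eq_zero, Finset.sdiff_eq_empty_iff_subset] at h0 h0'
      obtain rfl := Finset.Subset.antisymm h0 h0'
      apply hfg
      funext m
      by_cases hm : m ∈ A
      · exact hag m (by simpa using hm)
      · rw [hf.2 m hm, hg.2 m hm]
    · have hi1 : (A \ B).card = 1 := by omega
      have hj1 : (B \ A).card = 1 := by omega
      obtain ⟨i, hi⟩ := Finset.card_eq_one.1 hi1
      obtain ⟨j, hj⟩ := Finset.card_eq_one.1 hj1
      have hiA : i ∈ A \ B := by rw [hi]; simp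
      have hjB : j ∈ B \ A := by rw [hj]; simp
      have eA : insert i (A ∩ B) = A := by
        rw [Finset.insert_eq, ← hi]; exact Finset.sdiff_union_inter A B
      have eB : insert j (A ∩ B) = B := by
        rw [Finset.insert_eq, ← hj, Finset.inter_comm]; exact Finset.sdiff_union_inter B A
      rw [Finset.mem_sdiff] at hiA hjB
      refine signProb_hits_and_hits_le_of_insert (C := A ∩ B) (i := i) (j := j) ?_ ?_ ?_
        (by rwa [eA]) (by rwa [eB]) hag (by omega)
      · rintro rfl; exact hiA.2 hjB.1
      · simp [hiA.2]
      · simp [hjB.2]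
  have sq : ∀ m ∈ A ∩ B, g m * g m = 1 := by
    intro m hm
    rw [← abs_mul_abs_self, hg.1 m (Finset.mem_inter.1 hm).2, one_mul]
  rcases eq_or_eq_neg_of_abs_eq (show |f l * g l| = 1 by
    rw [abs_mul, hf.1 l hl'.1, hg.1 l hl'.2, one_mul]) with h | h
  · refine main hg h1 fun m hm => ?_
    have h3 := hmul m hm
    have h4 := sq m hm
    rw [h] at h3
    calc f m = f m * (g m * g m) := by rw [h4, mul_one]
      _ = g m := by rw [← mul_assoc, h3, one_mul]
  · have := main hg.neg h2 fun m hm => ?_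
    · rwa [signProb_congr fun s => and_congr_right fun _ => (hits_neg g s).symm]
    have h3 := hmul m hm
    have h4 := sq m hm
    rw [h] at h3
    calc f m = f m * (g m * g m) := by rw [h4, mul_one]
      _ = -g m := by rw [← mul_assoc, h3, neg_one_mul]

end Pairs

/-! ### Sunflowers -/

section Sunflowers

variable {ι : Type*} [Fintype ι] [DecidableEq ι]

/-- `a` is, up to sign, a coordinate functional. -/
def IsCoordinate (a : ι → ℝ) : Prop := ∃ i, IsSigned a {i}

theorem IsCoordinate.hits {a : ι → ℝ} (h : IsCoordinate a) (s : ι → ℤˣ) : Hits a s :=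
  let ⟨_, hi⟩ := h
  hi.hits_of_singleton s

theorem IsSigned.isCoordinate {a : ι → ℝ} {T : Finset ι} (h : IsSigned a T) (hT : T.card = 1) :
    IsCoordinate a := by
  obtain ⟨i, rfl⟩ := Finset.card_eq_one.1 hT
  exact ⟨i, h⟩

theorem isSigned_single {i : ι} {c : ℝ} (hc : |c| = 1) : IsSigned (Pi.single i c) {i} := by
  refine ⟨fun j hj => ?_, fun j hj => ?_⟩
  · rw [Finset.mem_singleton.1 hj, Pi.single_eq_same, hc]
  · rw [Pi.single_eq_of_ne (by simpa using hj)]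

theorem IsSigned.eq_single {a : ι → ℝ} {i : ι} (h : IsSigned a {i}) : a = Pi.single i (a i) := by
  funext j
  by_cases hj : j = i
  · subst hj; simp
  · rw [Pi.single_eq_of_ne hj, h.2 j (by simpa using hj)]

theorem signProb_hits_le_of_not_isCoordinate {a : ι → ℝ} (h : ¬ IsCoordinate a) :
    signProb (Hits a) ≤ 3 / 4 := by
  by_contra! hlt
  obtain ⟨T, hT, h1 | h1 | h1 | h1⟩ := exists_isSigned_of_half_lt (a := a) (by linarith)
  · exact h (hT.isCoordinate h1)
  · rw [hT.signProb_hits_three h1] at hlt; linarith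
  · rw [hT.signProb_hits_five h1] at hlt; linarith
  · rw [hT.signProb_hits_seven h1] at hlt; linarith

theorem IsSigned.mul_self {a : ι → ℝ} {T : Finset ι} (h : IsSigned a T) {i : ι} (hi : i ∈ T) :
    a i * a i = 1 := by
  rw [← abs_mul_abs_self, h.1 i hi, one_mul]

/-- The functional `e` is a signed pair of coordinates `p` and `q`, and the indices in `J` are
different from these. The petals of the sunflower are the functionals `e + τ j • e_j`, `j ∈ J`. -/
structure IsSunflower (e τ : ι → ℝ) (p q : ι) (J : Finset ι) : Prop where
  ne : p ≠ q
  kernel : IsSigned e {p, q}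
  left_notMem : p ∉ J
  right_notMem : q ∉ J
  abs_eq_one : ∀ j ∈ J, |τ j| = 1

/-- All petals of the sunflower take the values `±1`. -/
def PetalsHit (e τ : ι → ℝ) (J : Finset ι) (s : ι → ℤˣ) : Prop :=
  ∀ j ∈ J, Hits (e + Pi.single j (τ j)) s

/-- Eliminate the coordinate `q` by means of the equation `e = 0`. -/
def eliminate (e : ι → ℝ) (q : ι) (g : ι → ℝ) : ι → ℝ := g - (g q * e q) • e

theorem signDot_eliminate {e : ι → ℝ} {s : ι → ℤˣ} (q : ι) (g : ι → ℝ) (h : signDot e s = 0) :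
    signDot (eliminate e q g) s = signDot g s := by
  rw [eliminate, signDot_sub, signDot_smul, h]; ring

variable {e τ : ι → ℝ} {p q : ι} {J : Finset ι}

theorem petalsHit_insert {j : ι} (s : ι → ℤˣ) :
    PetalsHit e τ (insert j J) s ↔ Hits (e + Pi.single j (τ j)) s ∧ PetalsHit e τ J s := by
  simp [PetalsHit]

namespace IsSunflower

theorem abs_left (h : IsSunflower e τ p q J) : |e p| = 1 := h.kernel.1 p (by simp)

theorem abs_right (h : IsSunflower e τ p q J) : |e q| = 1 := h.kernel.1 q (by simp)

theorem apply_eq_zero (h : IsSunflower e τ p q J) {j : ι} (hp : j ≠ p) (hq : j ≠ q) : e j = 0 :=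
  h.kernel.2 j (by simp [hp, hq])

theorem signDot_kernel (h : IsSunflower e τ p q J) (s : ι → ℤˣ) :
    signDot e s = e p * signVal (s p) + e q * signVal (s q) := by
  rw [h.kernel.signDot_eq, Finset.sum_pair h.ne]

theorem kernel_cases (h : IsSunflower e τ p q J) (s : ι → ℤˣ) :
    signDot e s = 0 ∨ |signDot e s| = 2 := by
  rw [h.signDot_kernel]
  rcases mul_signVal_eq h.abs_left (s p) with h1 | h1 <;>
    rcases mul_signVal_eq h.abs_right (s q) with h2 | h2 <;> rw [h1, h2] <;> norm_num

theorem abs_kernel (h : IsSunflower e τ p q J) {s : ι → ℤˣ} (hs : signDot e s ≠ 0) :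
    |signDot e s| = 2 := (h.kernel_cases s).resolve_left hs

theorem kernel_flip (h : IsSunflower e τ p q J) (s : ι → ℤˣ) :
    signDot e (flipSign q s) = 0 ↔ ¬ signDot e s = 0 := by
  rw [signDot_flipSign, h.signDot_kernel]
  rcases mul_signVal_eq h.abs_left (s p) with h1 | h1 <;>
    rcases mul_signVal_eq h.abs_right (s q) with h2 | h2 <;> rw [h1, h2] <;> norm_num

theorem signProb_kernel_and (h : IsSunflower e τ p q J) {Q : (ι → ℤˣ) → Prop}
    (hQ : ∀ s, Q (flipSign q s) ↔ Q s) :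
    signProb (fun s => signDot e s = 0 ∧ Q s) = 1 / 2 * signProb Q :=
  signProb_and_of_flip q hQ fun s _ => h.kernel_flip s

theorem signProb_not_kernel_and (h : IsSunflower e τ p q J) {Q : (ι → ℤˣ) → Prop}
    (hQ : ∀ s, Q (flipSign q s) ↔ Q s) :
    signProb (fun s => signDot e s ≠ 0 ∧ Q s) = 1 / 2 * signProb Q :=
  signProb_and_of_flip q hQ fun s _ => not_congr (h.kernel_flip s)

theorem signProb_kernel (h : IsSunflower e τ p q J) :
    signProb (fun s => signDot e s = 0) = 1 / 2 := by
  have := h.signProb_kernel_and (Q := fun _ => True) (fun _ => Iff.rfl)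
  rw [signProb_of_forall (Q := fun _ : ι → ℤˣ => True) (fun _ => trivial)] at this
  simpa using this

theorem signProb_not_kernel (h : IsSunflower e τ p q J) :
    signProb (fun s => signDot e s ≠ 0) = 1 / 2 := by
  have := h.signProb_not_kernel_and (Q := fun _ => True) (fun _ => Iff.rfl)
  rw [signProb_of_forall (Q := fun _ : ι → ℤˣ => True) (fun _ => trivial)] at this
  simpa using this

theorem eliminate_apply_right (h : IsSunflower e τ p q J) (g : ι → ℝ) :
    eliminate e q g q = 0 := by
  have : e q * e q = 1 := h.kernel.mul_self (by simp)
  simp only [eliminate, Pi.sub_apply, Pi.smul_apply, smul_eq_mul]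
  rw [mul_assoc, this, mul_one, sub_self]

/-- On the kernel `g` may be replaced by a functional without `q`, and this one is independent of
the event `e = 0`, which the flip of `q` toggles. -/
theorem signProb_kernel_and_hits (h : IsSunflower e τ p q J) (g : ι → ℝ) :
    signProb (fun s => signDot e s = 0 ∧ Hits g s) =
      1 / 2 * signProb (Hits (eliminate e q g)) := by
  rw [← h.signProb_kernel_and (Q := Hits (eliminate e q g))
    (hits_flipSign (h.eliminate_apply_right g))]
  exact signProb_congr fun s => and_congr_right fun hs => hits_congr (signDot_eliminate q g hs).symm

theorem mono (h : IsSunflower e τ p q J) {J' : Finset ι} (hJ : J' ⊆ J) :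
    IsSunflower e τ p q J' :=
  ⟨h.ne, h.kernel, fun h1 => h.left_notMem (hJ h1), fun h1 => h.right_notMem (hJ h1),
    fun j hj => h.abs_eq_one j (hJ hj)⟩

theorem petalsHit_of_kernel (h : IsSunflower e τ p q J) {s : ι → ℤˣ} (hs : signDot e s = 0) :
    PetalsHit e τ J s := by
  intro j hj
  rw [Hits, signDot_add, hs, signDot_single, zero_add, abs_mul_signVal, h.abs_eq_one j hj]

/-- Where `|e| = 2`, a petal hits for exactly one value of its private sign, so each petal costs an
independent factor 1/2. -/
theorem signProb_not_kernel_and_petalsHit (h : IsSunflower e τ p q J) :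
    signProb (fun s => signDot e s ≠ 0 ∧ PetalsHit e τ J s) = 1 / 2 ^ (J.card + 1) := by
  induction J using Finset.induction_on with
  | empty => simpa [PetalsHit] using h.signProb_not_kernel
  | insert j J hj ih =>
    have h' := h.mono (Finset.subset_insert j J)
    have hjp : j ≠ p := by rintro rfl; exact h.left_notMem (by simp)
    have hjq : j ≠ q := by rintro rfl; exact h.right_notMem (by simp)
    have he0 : e j = 0 := h.apply_eq_zero hjp hjq
    have hej : ∀ s, signDot e (flipSign j s) = signDot e s := fun s => by
      rw [signDot_flipSign, he0]; ring
    have hτ := h.abs_eq_one j (by simp)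
    have key := signProb_and_of_flip (Q := fun s => signDot e s ≠ 0 ∧ PetalsHit e τ J s)
      (R := Hits (e + Pi.single j (τ j))) j ?_ ?_
    · rw [Finset.card_insert_of_notMem hj, pow_succ, ← div_div, ← ih h',
        ← mul_one_div, mul_comm, ← key]
      exact signProb_congr fun s => by rw [petalsHit_insert]; tauto
    · intro s
      rw [hej]
      refine and_congr_right fun _ => forall₂_congr fun k hk => hits_flipSign ?_ s
      rw [Pi.add_apply, he0, Pi.single_eq_of_ne (by rintro rfl; exact hj hk), add_zero]
    · rintro s ⟨hs, -⟩
      rw [Hits, Hits, signDot_add, signDot_add, hej, signDot_single, signDot_single,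
        flipSign_apply, if_pos rfl, signVal_neg, mul_neg]
      rcases eq_or_eq_neg_of_abs_eq (h.abs_kernel hs) with h1 | h1 <;>
        rcases mul_signVal_eq hτ (s j) with h2 | h2 <;> rw [h1, h2] <;> norm_num

theorem signProb_petalsHit_and (h : IsSunflower e τ p q J) (Q : (ι → ℤˣ) → Prop) :
    signProb (fun s => PetalsHit e τ J s ∧ Q s) =
      signProb (fun s => signDot e s = 0 ∧ Q s) +
        signProb (fun s => (signDot e s ≠ 0 ∧ PetalsHit e τ J s) ∧ Q s) := by
  rw [← signProb_or (fun s h1 h2 => h2.1.1 h1.1)]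
  refine signProb_congr fun s => ?_
  have := @petalsHit_of_kernel _ _ _ _ _ _ _ _ h s
  tauto

theorem signProb_petalsHit (h : IsSunflower e τ p q J) :
    signProb (PetalsHit e τ J) = 1 / 2 + 1 / 2 ^ (J.card + 1) := by
  have := h.signProb_petalsHit_and (fun _ => True)
  simpa only [and_true, h.signProb_kernel, h.signProb_not_kernel_and_petalsHit] using this

/-- A functional that stays nontrivial on the kernel cannot be added to a sunflower with at least
two petals. -/
theorem signProb_petalsHit_and_hits_le (h : IsSunflower e τ p q J) (hJ : 2 ≤ J.card) {g : ι → ℝ}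
    (hg : ¬ IsCoordinate (eliminate e q g)) :
    signProb (fun s => PetalsHit e τ J s ∧ Hits g s) ≤ 1 / 2 := by
  rw [h.signProb_petalsHit_and, h.signProb_kernel_and_hits]
  have h1 := signProb_hits_le_of_not_isCoordinate hg
  have h2 : signProb (fun s => (signDot e s ≠ 0 ∧ PetalsHit e τ J s) ∧ Hits g s) ≤
      signProb (fun s => signDot e s ≠ 0 ∧ PetalsHit e τ J s) :=
    signProb_mono fun s hs => hs.1
  rw [h.signProb_not_kernel_and_petalsHit] at h2
  -- Two petals are just enough: `1/2 * 3/4` from the kernel plus at most `1/8` from outside is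
  -- `1/2`.
  have h3 : (1 : ℝ) / 2 ^ (J.card + 1) ≤ 1 / 2 ^ 3 :=
    one_div_le_one_div_of_le (by positivity) (pow_le_pow_right₀ (by norm_num) (by omega))
  rw [show (1 : ℝ) / 2 ^ 3 = 1 / 8 by norm_num] at h3
  linarith

/-- All joint hits then lie in the kernel, which has probability 1/2. -/
theorem signProb_petalsHit_and_hits_le_of_forall (h : IsSunflower e τ p q J) {g : ι → ℝ}
    (hg : ∀ s, signDot e s ≠ 0 → PetalsHit e τ J s → ¬ Hits g s) :
    signProb (fun s => PetalsHit e τ J s ∧ Hits g s) ≤ 1 / 2 := by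
  rw [← h.signProb_kernel]
  refine signProb_mono fun s hs => ?_
  by_contra h0
  exact hg s h0 hs.1 hs.2

/-- A functional that is a coordinate on the kernel is a coordinate or a petal of a larger
sunflower, unless it makes the intersection small. -/
theorem cases_of_isCoordinate_eliminate (h : IsSunflower e τ p q J) {g : ι → ℝ}
    (hg : IsCoordinate (eliminate e q g)) :
    IsCoordinate g ∨
    (∃ j ∈ J, g = e + Pi.single j (τ j) ∨ g = -(e + Pi.single j (τ j))) ∨
    signProb (fun s => PetalsHit e τ J s ∧ Hits g s) ≤ 1 / 2 ∨
    ∃ τ' j, j ∉ J ∧ IsSunflower e τ' p q (insert j J) ∧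
      ∀ s, PetalsHit e τ' (insert j J) s ↔ PetalsHit e τ J s ∧ Hits g s := by
  obtain ⟨z, hz⟩ := hg
  have hzq : z ≠ q := by
    rintro rfl
    have := hz.1 z (by simp)
    rw [h.eliminate_apply_right] at this
    norm_num at this
  obtain ⟨σ, hσ⟩ : ∃ σ, σ = eliminate e q g z := ⟨_, rfl⟩
  obtain ⟨c, hc⟩ : ∃ c, c = g q * e q := ⟨_, rfl⟩
  have hσ1 : |σ| = 1 := hσ ▸ hz.1 z (by simp)
  -- So `g` is a signed coordinate `z` plus a multiple of `e`. The cases below depend on `c` and on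
  -- whether `z` is `p`, the private coordinate of a petal, or new.
  have hge : g = Pi.single z σ + c • e := by
    rw [hσ, ← hz.eq_single, eliminate, hc, sub_add_cancel]
  have hdot : ∀ s, signDot g s = σ * signVal (s z) + c * signDot e s := fun s => by
    rw [hge, signDot_add, signDot_smul, signDot_single]
  by_cases hc0 : c = 0
  · left
    rw [hge, hc0, zero_smul, add_zero]
    exact ⟨z, isSigned_single hσ1⟩
  by_cases hzp : z = p
  · subst hzp
    have hee : e z * e z = 1 := h.kernel.mul_self (by simp)
    have hde : ∀ s, signDot e s ≠ 0 → signDot e s = 2 * (e z * signVal (s z)) := by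
      intro s hs
      rw [h.signDot_kernel] at hs ⊢
      rcases mul_signVal_eq h.abs_left (s z) with h1 | h1 <;>
        rcases mul_signVal_eq h.abs_right (s q) with h2 | h2 <;> rw [h1, h2] at hs ⊢ <;>
        first
          | (norm_num; done)
          | (exfalso; apply hs; norm_num)
    -- Off the kernel `e` is twice its `p`-term, so `g` equals `(σ + 2 c e_p) s_p` there. It hits
    -- either always, in which case `g` is `±` the coordinate `q`, or never.
    by_cases h1 : |σ + 2 * (c * e z)| = 1
    · left
      have hce : c * e z = -σ := by
        have hne : c * e z ≠ 0 := by
          refine mul_ne_zero hc0 fun h0 => ?_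
          rw [h0] at hee; norm_num at hee
        rcases eq_or_eq_neg_of_abs_eq h1 with h2 | h2 <;>
          rcases eq_or_eq_neg_of_abs_eq hσ1 with h3 | h3 <;> rw [h3] at h2 <;>
          first
            | linarith
            | exact absurd (by linarith) hne
      have hcc : c = -σ * e z := by rw [← hce, mul_assoc, hee, mul_one]
      refine ⟨q, fun j hj => ?_, fun j hj => ?_⟩
      · rw [Finset.mem_singleton.1 hj, hge]
        simp only [Pi.add_apply, Pi.smul_apply, smul_eq_mul]
        rw [Pi.single_eq_of_ne hzq.symm, hcc, zero_add, abs_mul, abs_mul, abs_neg, hσ1,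
          h.abs_left, h.abs_right]
        norm_num
      · rw [hge]
        simp only [Pi.add_apply, Pi.smul_apply, smul_eq_mul]
        by_cases hjz : j = z
        · subst hjz
          rw [Pi.single_eq_same, hce]; ring
        · rw [Pi.single_eq_of_ne hjz, h.apply_eq_zero hjz (by simpa using hj)]; ring
    · right; right; left
      refine h.signProb_petalsHit_and_hits_le_of_forall fun s hs _ hg => h1 ?_
      rw [Hits, hdot, hde s hs] at hg
      rw [← abs_mul_signVal _ (s z), ← hg]
      congr 1; ring
  · by_cases hzJ : z ∈ J
    · have hττ : τ z * τ z = 1 := by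
        rw [← abs_mul_abs_self, h.abs_eq_one z hzJ, one_mul]
      -- Off the kernel the existing petal forces `τ z * s z = -e/2`; under this constraint `g` can
      -- hit only if it is `±` that petal.
      by_cases h1 : c = σ * τ z
      · right; left
        refine ⟨z, hzJ, ?_⟩
        have hσ' : σ = c * τ z := by rw [h1, mul_assoc, hττ, mul_one]
        have : |c| = 1 := by rw [h1, abs_mul, hσ1, h.abs_eq_one z hzJ, one_mul]
        rcases eq_or_eq_neg_of_abs_eq this with h2 | h2
        · left
          rw [hge, hσ', h2, one_smul, one_mul, add_comm]
        · right
          rw [hge, hσ', h2, neg_smul, one_smul, neg_one_mul, Pi.single_neg, neg_add, add_comm]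
      · right; right; left
        refine h.signProb_petalsHit_and_hits_le_of_forall fun s hs hp hg => ?_
        have h2 := hp z hzJ
        rw [Hits, signDot_add, signDot_single] at h2
        rw [Hits, hdot] at hg
        have h3 := h.abs_kernel hs
        generalize signDot e s = d at *
        rcases eq_or_eq_neg_of_abs_eq hσ1 with h4 | h4 <;>
        rcases eq_or_eq_neg_of_abs_eq (h.abs_eq_one z hzJ) with h5 | h5 <;>
        rcases signVal_eq (s z) with h6 | h6 <;>
        rcases eq_or_eq_neg_of_abs_eq h3 with h7 | h7 <;>
        rw [h4, h5] at h1 <;> rw [h5, h6, h7] at h2 <;> rw [h4, h6, h7] at hg <;>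
        norm_num at h2 <;>
        rcases eq_or_eq_neg_of_abs_eq hg with h8 | h8 <;>
        first
          | exact hc0 (by linarith)
          | exact h1 (by linarith)
    -- A fresh coordinate gives a new petal when `c = ±1`, with coefficient `c * σ` after
    -- normalizing the sign. Any other nonzero `c` rules out hits where `|e| = 2`.
    · by_cases h1 : |c| = 1
      · right; right; right
        refine ⟨Function.update τ z (c * σ), z, hzJ, ⟨h.ne, h.kernel, ?_, ?_, ?_⟩, fun s => ?_⟩
        · simp [h.left_notMem, Ne.symm hzp]
        · simp [h.right_notMem, hzq.symm]
        · intro j hj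
          by_cases hjz : j = z
          · subst hjz
            rw [Function.update_self, abs_mul, h1, hσ1, one_mul]
          · rw [Function.update_of_ne hjz]
            exact h.abs_eq_one j (Finset.mem_of_mem_insert_of_ne hj hjz)
        · rw [petalsHit_insert, and_comm]
          refine and_congr (forall₂_congr fun j hj => ?_) ?_
          · rw [Function.update_of_ne (by rintro rfl; exact hzJ hj)]
          · rw [Function.update_self, Hits, Hits, hdot, signDot_add, signDot_single]
            rcases eq_or_eq_neg_of_abs_eq h1 with h2 | h2
            · rw [h2, one_mul, one_mul, add_comm]
            · rw [h2, ← abs_neg]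
              congr! 2; ring
      · right; right; left
        refine h.signProb_petalsHit_and_hits_le_of_forall fun s hs _ hg => ?_
        rw [Hits, hdot] at hg
        rcases eq_or_eq_neg_of_abs_eq (h.abs_kernel hs) with h7 | h7 <;>
        rcases mul_signVal_eq hσ1 (s z) with h6 | h6 <;> rw [h6, h7] at hg <;>
        rcases eq_or_eq_neg_of_abs_eq hg with h8 | h8 <;>
        first
          | exact hc0 (by linarith)
          | (have h9 : c = 1 := by linarith
             exact h1 (by rw [h9, abs_one]))
          | (have h9 : c = -1 := by linarith
             exact h1 (by rw [h9, abs_neg, abs_one]))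

end IsSunflower

end Sunflowers

/-! ### Families containing a sum of three signs -/

section Triples

variable {ι : Type*} [Fintype ι] [DecidableEq ι]

theorem IsSigned.unique {a : ι → ℝ} {S T : Finset ι} (hS : IsSigned a S) (hT : IsSigned a T) :
    S = T := by
  have key : ∀ {S T : Finset ι}, IsSigned a S → IsSigned a T → S ⊆ T := by
    intro S T hS hT i hi
    by_contra h
    have := hS.1 i hi
    rw [hT.2 i h] at this
    norm_num at this
  exact Finset.Subset.antisymm (key hS hT) (key hT hS)

theorem IsSigned.not_isCoordinate {a : ι → ℝ} {T : Finset ι} (h : IsSigned a T)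
    (hT : T.card ≠ 1) : ¬ IsCoordinate a := by
  rintro ⟨i, hi⟩
  rw [h.unique hi] at hT
  simp at hT

theorem IsSigned.signProb_hits_congr {a b : ι → ℝ} {S T : Finset ι} (hS : IsSigned a S)
    (hT : IsSigned b T) (h : S.card = T.card) : signProb (Hits a) = signProb (Hits b) := by
  rcases Nat.even_or_odd S.card with he | ⟨r, hr⟩
  · rw [hS.signProb_hits_of_even he, hT.signProb_hits_of_even (h ▸ he)]
  · rw [hS.signProb_hits_of_odd hr, hT.signProb_hits_of_odd (h ▸ hr)]

/-- `f` is a signed sum of the three different coordinates `p`, `q`, `j`. -/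
structure IsTriple (f : ι → ℝ) (p q j : ι) : Prop where
  ne : p ≠ q
  ne_left : j ≠ p
  ne_right : j ≠ q
  isSigned : IsSigned f {p, q, j}

/-- The part of `f` on the two coordinates `p` and `q`. -/
def pairPart (f : ι → ℝ) (p q : ι) : ι → ℝ := Pi.single p (f p) + Pi.single q (f q)

/-- Eliminate the coordinates `q` and `j` by means of the equations
`f p s p = f q s q = - f j s j`. -/
def eliminatePair (f : ι → ℝ) (p q j : ι) (g : ι → ℝ) : ι → ℝ :=
  g - (g q * f q) • (Pi.single q (f q) - Pi.single p (f p)) -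
    (g j * f j) • (Pi.single j (f j) + Pi.single p (f p))

variable {f g h : ι → ℝ} {p q j : ι}

namespace IsTriple

theorem abs_left (hf : IsTriple f p q j) : |f p| = 1 := hf.isSigned.1 p (by simp)

theorem abs_middle (hf : IsTriple f p q j) : |f q| = 1 := hf.isSigned.1 q (by simp)

theorem abs_right (hf : IsTriple f p q j) : |f j| = 1 := hf.isSigned.1 j (by simp)

theorem isSunflower (hf : IsTriple f p q j) : IsSunflower (pairPart f p q) f p q {j} := by
  refine ⟨hf.ne, ⟨fun i hi => ?_, fun i hi => ?_⟩, ?_, ?_, ?_⟩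
  · rcases Finset.mem_insert.1 hi with rfl | hi
    · simp [pairPart, hf.ne, hf.abs_left]
    · rw [Finset.mem_singleton.1 hi]
      simp [pairPart, hf.ne.symm, hf.abs_middle]
  · simp only [Finset.mem_insert, Finset.mem_singleton, not_or] at hi
    simp [pairPart, hi.1, hi.2]
  · simpa using hf.ne_left.symm
  · simpa using hf.ne_right.symm
  · intro i hi
    rw [Finset.mem_singleton.1 hi, hf.abs_right]

theorem eq_add (hf : IsTriple f p q j) : f = pairPart f p q + Pi.single j (f j) := by
  funext i
  simp only [pairPart, Pi.add_apply]
  by_cases h1 : i = p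
  · subst h1; simp [hf.ne, hf.ne_left.symm]
  by_cases h2 : i = q
  · subst h2; simp [h1, hf.ne_right.symm]
  by_cases h3 : i = j
  · subst h3; simp [h1, h2]
  · simp [h1, h2, h3, hf.isSigned.2 i (by simp [h1, h2, h3])]

theorem petalsHit_iff (hf : IsTriple f p q j) (s : ι → ℤˣ) :
    PetalsHit (pairPart f p q) f {j} s ↔ Hits f s := by
  simp only [PetalsHit, Finset.mem_singleton, forall_eq]
  rw [← hf.eq_add]

theorem signProb_hits_and (hf : IsTriple f p q j) (Q : (ι → ℤˣ) → Prop) :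
    signProb (fun s => Hits f s ∧ Q s) =
      signProb (fun s => signDot (pairPart f p q) s = 0 ∧ Q s) +
        signProb (fun s => (signDot (pairPart f p q) s ≠ 0 ∧ Hits f s) ∧ Q s) := by
  simpa only [hf.petalsHit_iff] using hf.isSunflower.signProb_petalsHit_and Q

theorem eliminatePair_apply_middle (hf : IsTriple f p q j) (g : ι → ℝ) :
    eliminatePair f p q j g q = 0 := by
  have : f q * f q = 1 := hf.isSigned.mul_self (by simp)
  simp only [eliminatePair, Pi.sub_apply, Pi.smul_apply, Pi.add_apply, smul_eq_mul,
    Pi.single_eq_same, Pi.single_eq_of_ne hf.ne.symm, Pi.single_eq_of_ne hf.ne_right.symm]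
  linear_combination -g q * this

theorem eliminatePair_apply_right (hf : IsTriple f p q j) (g : ι → ℝ) :
    eliminatePair f p q j g j = 0 := by
  have : f j * f j = 1 := hf.isSigned.mul_self (by simp)
  simp only [eliminatePair, Pi.sub_apply, Pi.smul_apply, Pi.add_apply, smul_eq_mul,
    Pi.single_eq_same, Pi.single_eq_of_ne hf.ne_left, Pi.single_eq_of_ne hf.ne_right]
  linear_combination -g j * this

theorem eliminatePair_apply_left (hf : IsTriple f p q j) (g : ι → ℝ) :
    eliminatePair f p q j g p = f p * (f p * g p + f q * g q - f j * g j) := by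
  have : f p * f p = 1 := hf.isSigned.mul_self (by simp)
  simp only [eliminatePair, Pi.sub_apply, Pi.smul_apply, Pi.add_apply, smul_eq_mul,
    Pi.single_eq_same, Pi.single_eq_of_ne hf.ne, Pi.single_eq_of_ne hf.ne_left.symm]
  linear_combination -g p * this

theorem eliminatePair_apply_of_ne {i : ι} (hp : i ≠ p) (hq : i ≠ q)
    (hj : i ≠ j) (g : ι → ℝ) : eliminatePair f p q j g i = g i := by
  simp only [eliminatePair, Pi.sub_apply, Pi.smul_apply, Pi.add_apply, smul_eq_mul,
    Pi.single_eq_of_ne hp, Pi.single_eq_of_ne hq, Pi.single_eq_of_ne hj]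
  ring

theorem signDot_pairPart (s : ι → ℤˣ) :
    signDot (pairPart f p q) s = f p * signVal (s p) + f q * signVal (s q) := by
  rw [pairPart, signDot_add, signDot_single, signDot_single]

theorem signDot_eliminatePair (hf : IsTriple f p q j) (g : ι → ℝ) {s : ι → ℤˣ}
    (hs : signDot (pairPart f p q) s ≠ 0 ∧ Hits f s) :
    signDot (eliminatePair f p q j g) s = signDot g s := by
  obtain ⟨h1, h2⟩ := hs
  rw [Hits, hf.eq_add, signDot_add, signDot_single] at h2
  rw [signDot_pairPart] at h1 h2
  simp only [eliminatePair, signDot_sub, signDot_smul, signDot_add, signDot_single]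
  rcases mul_signVal_eq hf.abs_left (s p) with h3 | h3 <;>
    rcases mul_signVal_eq hf.abs_middle (s q) with h4 | h4 <;>
    rcases mul_signVal_eq hf.abs_right (s j) with h5 | h5 <;>
    rw [h3, h4] at h1 <;> rw [h3, h4, h5] at h2 <;> rw [h3, h4, h5] <;>
    first
      | (exfalso; norm_num at h1; done)
      | (exfalso; norm_num at h2; done)
      | ring

/-- Flipping `q` toggles the kernel, and off the kernel flipping `j` toggles `Hits f`; an event
independent of both signs is therefore halved twice. -/
theorem signProb_not_kernel_and_hits_and (hf : IsTriple f p q j) {Q : (ι → ℤˣ) → Prop}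
    (hq : ∀ s, Q (flipSign q s) ↔ Q s) (hj : ∀ s, Q (flipSign j s) ↔ Q s) :
    signProb (fun s => (signDot (pairPart f p q) s ≠ 0 ∧ Hits f s) ∧ Q s) =
      1 / 4 * signProb Q := by
  have h1 := hf.isSunflower.signProb_not_kernel_and hq
  have he : ∀ s, signDot (pairPart f p q) (flipSign j s) = signDot (pairPart f p q) s := fun s => by
    rw [signDot_flipSign, hf.isSunflower.apply_eq_zero hf.ne_left hf.ne_right]; ring
  have h2 := signProb_and_of_flip (Q := fun s => signDot (pairPart f p q) s ≠ 0 ∧ Q s)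
    (R := Hits f) j (fun s => by rw [he, hj]) ?_
  · rw [h1] at h2
    rw [signProb_congr (R := fun s => Hits f s ∧ signDot (pairPart f p q) s ≠ 0 ∧ Q s)
      (fun s => by tauto), h2]
    ring
  · rintro s ⟨hs, -⟩
    rw [hf.eq_add, Hits, Hits, signDot_add, signDot_add, he, signDot_single, signDot_single,
      flipSign_apply, if_pos rfl, signVal_neg, mul_neg]
    rcases eq_or_eq_neg_of_abs_eq (hf.isSunflower.abs_kernel hs) with h1 | h1 <;>
      rcases mul_signVal_eq hf.abs_right (s j) with h2 | h2 <;> rw [h1, h2] <;> norm_num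

theorem signProb_not_kernel_and_hits_and_hits (hf : IsTriple f p q j) (g : ι → ℝ) :
    signProb (fun s => (signDot (pairPart f p q) s ≠ 0 ∧ Hits f s) ∧ Hits g s) =
      1 / 4 * signProb (Hits (eliminatePair f p q j g)) := by
  rw [← hf.signProb_not_kernel_and_hits_and (Q := Hits (eliminatePair f p q j g))
    (hits_flipSign (hf.eliminatePair_apply_middle g))
    (hits_flipSign (hf.eliminatePair_apply_right g))]
  exact signProb_congr fun s => and_congr_right fun hs =>
    hits_congr (hf.signDot_eliminatePair g hs).symm

/-- On the kernel of the pair `f` always hits, which has weight 1/2. Off it, a hit of `f` ties the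
three signs to a single one, which has weight 1/4. On each piece `g` reduces to a functional of the
remaining free signs. -/
theorem signProb_hits_and_hits (hf : IsTriple f p q j) (g : ι → ℝ) :
    signProb (fun s => Hits f s ∧ Hits g s) =
      1 / 2 * signProb (Hits (eliminate (pairPart f p q) q g)) +
        1 / 4 * signProb (Hits (eliminatePair f p q j g)) := by
  rw [hf.signProb_hits_and, hf.isSunflower.signProb_kernel_and_hits,
    hf.signProb_not_kernel_and_hits_and_hits]

theorem eliminate_apply_of_ne {i : ι} (hp : i ≠ p) (hq : i ≠ q) (g : ι → ℝ) :
    eliminate (pairPart f p q) q g i = g i := by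
  simp [eliminate, pairPart, hp, hq]

theorem eliminate_apply_left (hf : IsTriple f p q j) (g : ι → ℝ) :
    eliminate (pairPart f p q) q g p = f p * (f p * g p - f q * g q) := by
  have : f p * f p = 1 := hf.isSigned.mul_self (by simp)
  simp only [eliminate, pairPart, Pi.sub_apply, Pi.smul_apply, Pi.add_apply, smul_eq_mul,
    Pi.single_eq_same, Pi.single_eq_of_ne hf.ne, Pi.single_eq_of_ne hf.ne.symm]
  linear_combination -g p * this

/-- The functional `g` stays a sum of three signs, both where the pair of `f` vanishes and where
it does not. -/
structure Splits (f g : ι → ℝ) (p q j : ι) : Prop where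
  isTriple : IsTriple f p q j
  not_isCoordinate_eliminate : ¬ IsCoordinate (eliminate (pairPart f p q) q g)
  not_isCoordinate_eliminatePair : ¬ IsCoordinate (eliminatePair f p q j g)
  signProb_eliminate : signProb (Hits (eliminate (pairPart f p q) q g)) = 3 / 4
  signProb_eliminatePair : signProb (Hits (eliminatePair f p q j g)) = 3 / 4

theorem Splits.signProb_hits_and_hits (h : Splits f g p q j) :
    signProb (fun s => Hits f s ∧ Hits g s) = 9 / 16 := by
  rw [h.isTriple.signProb_hits_and_hits, h.signProb_eliminate, h.signProb_eliminatePair]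
  norm_num

end IsTriple

/-- By pigeonhole, two of the three coordinates lie on the same side of `B`. Taking these as the
pair makes the elimination from a functional with support `B` clean. -/
theorem IsSigned.exists_isTriple {T B : Finset ι} (hf : IsSigned f T) (hT : T.card = 3) :
    ∃ p q j, IsTriple f p q j ∧ (p ∈ B ↔ q ∈ B) := by
  obtain ⟨x, y, z, hxy, hxz, hyz, rfl⟩ := Finset.card_eq_three.1 hT
  by_cases h1 : x ∈ B ↔ y ∈ B
  · exact ⟨x, y, z, ⟨hxy, hxz.symm, hyz.symm, hf⟩, h1⟩
  by_cases h2 : x ∈ B ↔ z ∈ B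
  · refine ⟨x, z, y, ⟨hxz, hxy.symm, hyz, ?_⟩, h2⟩
    rwa [Finset.pair_comm z y]
  · refine ⟨y, z, x, ⟨hyz, hxy, hxz, ?_⟩, by tauto⟩
    rwa [Finset.pair_comm z x, Finset.insert_comm]

/-- The hypothesis says that `g` is proportional to the pair on `{p, q}`, so elimination deletes
both coordinates. -/
theorem IsTriple.eliminate_isSigned {B : Finset ι} (hf : IsTriple f p q j) (hg : IsSigned g B)
    (hpq : f p * g p = f q * g q) :
    IsSigned (eliminate (pairPart f p q) q g) ((B.erase p).erase q) := by
  refine ⟨fun i hi => ?_, fun i hi => ?_⟩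
  · simp only [Finset.mem_erase] at hi
    rw [IsTriple.eliminate_apply_of_ne hi.2.1 hi.1, hg.1 i hi.2.2]
  · by_cases hip : i = p
    · rw [hip, hf.eliminate_apply_left, hpq, sub_self, mul_zero]
    by_cases hiq : i = q
    · rw [hiq, hf.isSunflower.eliminate_apply_right]
    · rw [IsTriple.eliminate_apply_of_ne hip hiq]
      apply hg.2
      simpa [hip, hiq] using hi

/-- The intersection of a sum of three signs with another functional: it is small, or a sunflower
with two petals, or the second functional splits into two sums of three signs. -/
theorem IsSigned.cases_of_card_eq_three {T : Finset ι} (hf : IsSigned f T) (hT : T.card = 3)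
    (hg : ¬ IsCoordinate g) (h1 : g ≠ f) (h2 : g ≠ -f) :
    signProb (fun s => Hits f s ∧ Hits g s) ≤ 1 / 2 ∨
    (∃ e τ p q J, IsSunflower e τ p q J ∧ J.card = 2 ∧
      ∀ s, PetalsHit e τ J s ↔ Hits f s ∧ Hits g s) ∨
    ∃ p q j, IsTriple.Splits f g p q j := by
  by_cases hlarge : signProb (fun s => Hits f s ∧ Hits g s) ≤ 1 / 2
  · exact Or.inl hlarge
  right
  obtain ⟨B, hB, -⟩ := exists_isSigned_of_half_lt (a := g)
    ((not_le.1 hlarge).trans_le (signProb_mono fun s hs => hs.2))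
  have hsign : ∀ x ∈ T, x ∈ B → ∀ y ∈ T, y ∈ B → f x * g x = f y * g y := by
    intro x hx hx' y hy hy'
    by_contra hne
    exact hlarge (signProb_hits_and_hits_le_of_mul_ne (hf.1 x hx) (hf.1 y hy) (hB.1 x hx')
      (hB.1 y hy') hne)
  obtain ⟨p, q, j, ht, hpq⟩ := hf.exists_isTriple (B := B) hT
  obtain rfl := hf.unique ht.isSigned
  by_cases hc : IsCoordinate (eliminate (pairPart f p q) q g)
  · rcases ht.isSunflower.cases_of_isCoordinate_eliminate hc with h | ⟨i, hi, h⟩ | h | h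
    · exact absurd h hg
    · rw [Finset.mem_singleton.1 hi, ← ht.eq_add] at h
      exact absurd h (not_or.2 ⟨h1, h2⟩)
    · simp only [ht.petalsHit_iff] at h
      exact absurd h hlarge
    · obtain ⟨τ', i, hi, hs, hiff⟩ := h
      refine Or.inl ⟨_, _, _, _, _, hs, ?_, fun s => by rw [hiff, ht.petalsHit_iff]⟩
      rw [Finset.card_insert_of_notMem hi, Finset.card_singleton]
  right
  have hfg : f p * g p = f q * g q := by
    by_cases hp : p ∈ B
    · exact hsign p (by simp) hp q (by simp) (hpq.1 hp)
    · rw [hB.2 p hp, hB.2 q (fun h => hp (hpq.2 h)), mul_zero, mul_zero]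
  have hS1 := ht.eliminate_isSigned hB hfg
  have hle := ht.signProb_hits_and_hits g
  -- In this case the reduction off the kernel has coefficient `±2` at `p`, hence probability at
  -- most 1/2, and the total is at most `1/2 * 3/4 + 1/4 * 1/2 = 1/2`.
  by_cases hj : p ∈ B ∧ j ∉ B
  · exfalso
    have hsmall := signProb_hits_le_of_not_isCoordinate hc
    have hP : ¬ 1 / 2 < signProb (Hits (eliminatePair f p q j g)) := by
      intro h
      obtain ⟨S, hS, -⟩ := exists_isSigned_of_half_lt h
      have hval := ht.eliminatePair_apply_left g
      rw [hB.2 j hj.2, ← hfg] at hval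
      have habs : |eliminatePair f p q j g p| = 2 := by
        rw [hval, show f p * (f p * g p + f p * g p - f j * 0) = 2 * (f p * f p * g p) by ring,
          ht.isSigned.mul_self (by simp), one_mul, abs_mul, hB.1 p hj.1]
        norm_num
      by_cases hpS : p ∈ S
      · rw [hS.1 p hpS] at habs; norm_num at habs
      · rw [hS.2 p hpS] at habs; norm_num at habs
    linarith
  -- In the remaining cases both reductions are signed sums of equal length: off the kernel, `p`,
  -- `q`, `j` merge into one sign at `p`, `j` is replaced by `p`, or nothing changes.
  obtain ⟨S2, hS2, hcard⟩ : ∃ S2, IsSigned (eliminatePair f p q j g) S2 ∧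
      ((B.erase p).erase q).card = S2.card := by
    by_cases hp : p ∈ B
    · have hq := hpq.1 hp
      have hj : j ∈ B := by tauto
      refine ⟨(B.erase q).erase j, ⟨fun i hi => ?_, fun i hi => ?_⟩, ?_⟩
      · simp only [Finset.mem_erase] at hi
        by_cases hip : i = p
        · rw [hip, ht.eliminatePair_apply_left, ← hfg, hsign p (by simp) hp j (by simp) hj,
            add_sub_cancel_right, abs_mul, abs_mul, ht.abs_left, ht.abs_right, hB.1 j hj]
          norm_num
        · rw [IsTriple.eliminatePair_apply_of_ne hip hi.2.1 hi.1, hB.1 i hi.2.2]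
      · by_cases hiq : i = q
        · rw [hiq, ht.eliminatePair_apply_middle]
        by_cases hij : i = j
        · rw [hij, ht.eliminatePair_apply_right]
        have hiB : i ∉ B := by simpa [hiq, hij] using hi
        rw [IsTriple.eliminatePair_apply_of_ne (by rintro rfl; exact hiB hp) hiq hij, hB.2 i hiB]
      · rw [Finset.card_erase_of_mem (by simp [ht.ne.symm, hq]), Finset.card_erase_of_mem hp,
          Finset.card_erase_of_mem (by simp [ht.ne_right, hj]), Finset.card_erase_of_mem hq]
    · have hq : q ∉ B := fun h => hp (hpq.2 h)
      rw [Finset.erase_eq_of_notMem hp, Finset.erase_eq_of_notMem hq]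
      by_cases hj : j ∈ B
      · refine ⟨insert p (B.erase j), ⟨fun i hi => ?_, fun i hi => ?_⟩, ?_⟩
        · by_cases hip : i = p
          · rw [hip, ht.eliminatePair_apply_left, hB.2 p hp, hB.2 q hq, mul_zero, mul_zero,
              add_zero, zero_sub, abs_mul, abs_neg, abs_mul, ht.abs_left, ht.abs_right, hB.1 j hj]
            norm_num
          · have hi' := Finset.mem_of_mem_insert_of_ne hi hip
            rw [Finset.mem_erase] at hi'
            rw [IsTriple.eliminatePair_apply_of_ne hip (by rintro rfl; exact hq hi'.2) hi'.1,
              hB.1 i hi'.2]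
        · simp only [Finset.mem_insert, Finset.mem_erase, not_or, not_and] at hi
          by_cases hiq : i = q
          · rw [hiq, ht.eliminatePair_apply_middle]
          by_cases hij : i = j
          · rw [hij, ht.eliminatePair_apply_right]
          rw [IsTriple.eliminatePair_apply_of_ne hi.1 hiq hij, hB.2 i (hi.2 hij)]
        · rw [Finset.card_insert_of_notMem (by simp [hp]), Finset.card_erase_add_one hj]
      · refine ⟨B, ⟨fun i hi => ?_, fun i hi => ?_⟩, rfl⟩
        · rw [IsTriple.eliminatePair_apply_of_ne (by rintro rfl; exact hp hi)
            (by rintro rfl; exact hq hi) (by rintro rfl; exact hj hi), hB.1 i hi]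
        · by_cases hip : i = p
          · rw [hip, ht.eliminatePair_apply_left, hB.2 p hp, hB.2 q hq, hB.2 j hj]
            ring
          by_cases hiq : i = q
          · rw [hiq, ht.eliminatePair_apply_middle]
          by_cases hij : i = j
          · rw [hij, ht.eliminatePair_apply_right]
          rw [IsTriple.eliminatePair_apply_of_ne hip hiq hij, hB.2 i hi]
  -- Both reductions have the same probability `x`, and the total `3/4 * x` exceeds 1/2 only for
  -- lengths 1 and 3; length 1 is already excluded.
  have heq := hS1.signProb_hits_congr hS2 hcard
  obtain ⟨S, hS, hcS⟩ := exists_isSigned_of_half_lt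
    (a := eliminate (pairPart f p q) q g) (by linarith)
  obtain rfl := hS1.unique hS
  rcases hcS with h | h | h | h
  · exact absurd (hS1.isCoordinate h) hc
  · exact ⟨p, q, j, ht, hc, hS2.not_isCoordinate (by omega), hS1.signProb_hits_three h,
      hS2.signProb_hits_three (by omega)⟩
  · rw [hS1.signProb_hits_five h] at heq hle; linarith
  · rw [hS1.signProb_hits_seven h] at heq hle; linarith

/-- Two different nontrivial functionals hit simultaneously with probability at most `5 / 8`. -/
theorem signProb_hits_and_hits_le_of_ne (hf : ¬ IsCoordinate f) (hg : ¬ IsCoordinate g)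
    (h1 : g ≠ f) (h2 : g ≠ -f) : signProb (fun s => Hits f s ∧ Hits g s) ≤ 5 / 8 := by
  by_contra! hlt
  have aux : ∀ {f g : ι → ℝ} {T : Finset ι}, IsSigned f T → T.card = 3 → ¬ IsCoordinate g →
      g ≠ f → g ≠ -f → signProb (fun s => Hits f s ∧ Hits g s) ≤ 5 / 8 := by
    intro f g T hf hT hg h1 h2
    rcases hf.cases_of_card_eq_three hT hg h1 h2 with h | ⟨e, τ, p, q, J, hs, hJ, hiff⟩ |
      ⟨p, q, j, h⟩
    · linarith
    · rw [← signProb_congr hiff, hs.signProb_petalsHit, hJ]; norm_num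
    · rw [h.signProb_hits_and_hits]; norm_num
  obtain ⟨A, hA, hA'⟩ := exists_isSigned_of_half_lt (a := f)
    (lt_of_lt_of_le (by linarith) (signProb_mono fun s hs => hs.1 :
      signProb (fun s => Hits f s ∧ Hits g s) ≤ _))
  obtain ⟨B, hB, hB'⟩ := exists_isSigned_of_half_lt (a := g)
    (lt_of_lt_of_le (by linarith) (signProb_mono fun s hs => hs.2 :
      signProb (fun s => Hits f s ∧ Hits g s) ≤ _))
  have hA1 : A.card ≠ 1 := fun h => hf (hA.isCoordinate h)
  have hB1 : B.card ≠ 1 := fun h => hg (hB.isCoordinate h)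
  by_cases hA3 : A.card = 3
  · linarith [aux hA hA3 hg h1 h2]
  by_cases hB3 : B.card = 3
  · have := aux hB hB3 hf h1.symm (fun h => h2 (by rw [h, neg_neg]))
    rw [signProb_congr fun s => and_comm] at this
    linarith
  · linarith [signProb_hits_and_hits_le_of_card hA hB (by tauto) (by tauto) h1.symm
      (fun h => h2 (by rw [h, neg_neg]))]

theorem mul_add_eq_zero_of_abs {x y c d : ℝ} (hc : c ≠ 0) (hd : d ≠ 0) (hx : |x| = 1)
    (hy : |y| = 1) (h : y = x + c * d) : 2 * x + c * d = 0 := by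
  have hcd : c * d ≠ 0 := mul_ne_zero hc hd
  rcases eq_or_eq_neg_of_abs_eq hx with rfl | rfl <;>
    rcases eq_or_eq_neg_of_abs_eq hy with rfl | rfl
  · exact absurd (by linarith) hcd
  · linarith
  · linarith
  · exact absurd (by linarith) hcd

theorem IsTriple.eliminatePair_add_smul (g e : ι → ℝ) (b c : ℝ) :
    eliminatePair f p q j (b • g + c • e) =
      b • eliminatePair f p q j g + c • eliminatePair f p q j e := by
  funext i
  simp only [eliminatePair, Pi.sub_apply, Pi.smul_apply, Pi.add_apply, smul_eq_mul]
  ring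

/-- Off the kernel `g` and `h` take different values, so when both hit the values are opposite, that
is `2 g + c e = 0`. This is a nontrivial linear condition, of probability at most 1/2, and the total
is at most `1/2 * 3/4 + 1/4 * 1/2 = 1/2`. -/
theorem IsTriple.Splits.signProb_le_of_eq_add (hs : IsTriple.Splits f g p q j) {c : ℝ}
    (hc : c ≠ 0) (hh : h = g + c • pairPart f p q) :
    signProb (fun s => Hits f s ∧ Hits g s ∧ Hits h s) ≤ 1 / 2 := by
  have ht := hs.isTriple
  set v : ι → ℝ := (2 : ℝ) • g + c • pairPart f p q with hv
  -- The reduction of the pair lives on `p` alone, so if `v` reduced to 0, then so would `g` reduce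
  -- to a multiple of the coordinate `p`.
  have hv0 : eliminatePair f p q j v ≠ 0 := by
    intro h0
    rw [hv, IsTriple.eliminatePair_add_smul] at h0
    have hsingle : ∀ i, i ≠ p → eliminatePair f p q j g i = 0 := by
      intro i hip
      by_cases hiq : i = q
      · rw [hiq, ht.eliminatePair_apply_middle]
      by_cases hij : i = j
      · rw [hij, ht.eliminatePair_apply_right]
      have := congrFun h0 i
      simp only [Pi.add_apply, Pi.smul_apply, smul_eq_mul, Pi.zero_apply] at this
      rw [IsTriple.eliminatePair_apply_of_ne hip hiq hij (pairPart f p q),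
        ht.isSunflower.apply_eq_zero hip hiq] at this
      linarith
    obtain ⟨S, hS, hcS⟩ := exists_isSigned_of_half_lt (a := eliminatePair f p q j g)
      (by rw [hs.signProb_eliminatePair]; norm_num)
    have hSp : S ⊆ {p} := by
      intro i hi
      by_contra hip
      have := hS.1 i hi
      rw [hsingle i (by simpa using hip)] at this
      norm_num at this
    have := Finset.card_le_card hSp
    rw [Finset.card_singleton] at this
    exact hs.not_isCoordinate_eliminatePair (hS.isCoordinate (by omega))
  have h1 : signProb (fun s => signDot (pairPart f p q) s = 0 ∧ Hits g s ∧ Hits h s) ≤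
      signProb (fun s => signDot (pairPart f p q) s = 0 ∧ Hits g s) :=
    signProb_mono fun s hs => ⟨hs.1, hs.2.1⟩
  rw [ht.isSunflower.signProb_kernel_and_hits, hs.signProb_eliminate] at h1
  have h2 : signProb (fun s => (signDot (pairPart f p q) s ≠ 0 ∧ Hits f s) ∧ Hits g s ∧ Hits h s) ≤
      signProb (fun s => (signDot (pairPart f p q) s ≠ 0 ∧ Hits f s) ∧
        signDot (eliminatePair f p q j v) s = 0) := by
    refine signProb_mono fun s hs => ⟨hs.1, ?_⟩
    rw [ht.signDot_eliminatePair v hs.1, hv, signDot_add, signDot_smul, signDot_smul]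
    exact mul_add_eq_zero_of_abs hc hs.1.1 hs.2.1 hs.2.2 (by rw [hh, signDot_add, signDot_smul])
  have hflip : ∀ i, eliminatePair f p q j v i = 0 → ∀ s,
      signDot (eliminatePair f p q j v) (flipSign i s) = 0 ↔
        signDot (eliminatePair f p q j v) s = 0 := by
    intro i hi s
    rw [signDot_flipSign, hi]; simp
  rw [ht.signProb_not_kernel_and_hits_and (Q := fun s => signDot (eliminatePair f p q j v) s = 0)
    (hflip q (ht.eliminatePair_apply_middle v))
    (hflip j (ht.eliminatePair_apply_right v))] at h2
  have h3 := signProb_signDot_eq_zero_le hv0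
  rw [ht.signProb_hits_and]
  linarith

/-- A third functional makes the intersection small if it is nontrivial on the kernel. -/
theorem IsTriple.Splits.signProb_le (hs : IsTriple.Splits f g p q j)
    (hh : ¬ IsCoordinate (eliminate (pairPart f p q) q h)) (h1 : h ≠ g) (h2 : h ≠ -g) :
    signProb (fun s => Hits f s ∧ Hits g s ∧ Hits h s) ≤ 1 / 2 := by
  have ht := hs.isTriple
  have hadd : ∀ a : ι → ℝ, a = eliminate (pairPart f p q) q a +
      (a q * pairPart f p q q) • pairPart f p q := fun a => by
    rw [eliminate, sub_add_cancel]
  by_cases hp : eliminate (pairPart f p q) q h = eliminate (pairPart f p q) q g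
  · refine hs.signProb_le_of_eq_add (c := h q * pairPart f p q q - g q * pairPart f p q q) ?_ ?_
    · intro h0
      apply h1
      rw [hadd h, hadd g, hp, sub_eq_zero.1 h0]
    · rw [sub_smul]
      conv_lhs => rw [hadd h, hp]
      conv_rhs => enter [1]; rw [hadd g]
      abel
  by_cases hn : eliminate (pairPart f p q) q h = -eliminate (pairPart f p q) q g
  · rw [signProb_congr fun s => and_congr_right fun _ => and_congr_right fun _ =>
      (hits_neg h s).symm]
    refine hs.signProb_le_of_eq_add (c := -(h q * pairPart f p q q) - g q * pairPart f p q q) ?_ ?_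
    · intro h0
      apply h2
      rw [hadd h, hadd g, hn, ← sub_eq_zero.1 h0, neg_smul]
      abel
    · rw [sub_smul, neg_smul]
      conv_lhs => rw [hadd h, hn]
      conv_rhs => enter [1]; rw [hadd g]
      abel
  -- On the kernel `g` and `h` are now different nontrivial functionals, with joint probability at
  -- most 5/8. The total is at most `1/2 * 5/8 + 1/4 * 3/4 = 1/2`.
  have e1 : signProb (fun s => signDot (pairPart f p q) s = 0 ∧ Hits g s ∧ Hits h s) =
      1 / 2 * signProb (fun s => Hits (eliminate (pairPart f p q) q g) s ∧
        Hits (eliminate (pairPart f p q) q h) s) := by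
    rw [← ht.isSunflower.signProb_kernel_and (fun s => and_congr
      (hits_flipSign (ht.isSunflower.eliminate_apply_right g) s)
      (hits_flipSign (ht.isSunflower.eliminate_apply_right h) s))]
    exact signProb_congr fun s => and_congr_right fun hs => and_congr
      (hits_congr (signDot_eliminate q g hs).symm) (hits_congr (signDot_eliminate q h hs).symm)
  have h3 := signProb_hits_and_hits_le_of_ne hs.not_isCoordinate_eliminate hh hp hn
  have h4 : signProb (fun s => (signDot (pairPart f p q) s ≠ 0 ∧ Hits f s) ∧ Hits g s ∧ Hits h s) ≤
      signProb (fun s => (signDot (pairPart f p q) s ≠ 0 ∧ Hits f s) ∧ Hits g s) :=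
    signProb_mono fun s hs => ⟨hs.1, hs.2.1⟩
  rw [ht.signProb_not_kernel_and_hits_and_hits, hs.signProb_eliminatePair] at h4
  rw [ht.signProb_hits_and, e1]
  linarith

end Triples

/-! ### The large probabilities -/

section Families

variable {ι : Type*} [Fintype ι] [DecidableEq ι] {e τ : ι → ℝ} {p q : ι} {J : Finset ι}

theorem IsSunflower.card_add_two_le (h : IsSunflower e τ p q J) :
    J.card + 2 ≤ Fintype.card ι := by
  have hq := h.right_notMem
  have hp : p ∉ insert q J := by simp [h.ne, h.left_notMem]
  have := Finset.card_le_univ (insert p (insert q J))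
  rwa [Finset.card_insert_of_notMem hp, Finset.card_insert_of_notMem hq] at this

/-- A sunflower together with further functionals is small or again a sunflower. -/
theorem IsSunflower.extend (h : IsSunflower e τ p q J) (hJ : 2 ≤ J.card)
    (G : Finset (ι → ℝ)) :
    signProb (fun s => PetalsHit e τ J s ∧ ∀ a ∈ G, Hits a s) ≤ 1 / 2 ∨
    ∃ τ' J', IsSunflower e τ' p q J' ∧ 2 ≤ J'.card ∧ J'.card ≤ J.card + G.card ∧
      ∀ s, PetalsHit e τ' J' s ↔ PetalsHit e τ J s ∧ ∀ a ∈ G, Hits a s := by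
  classical
  induction G using Finset.induction_on with
  | empty => exact Or.inr ⟨τ, J, h, hJ, by simp, by simp⟩
  | insert g G hg ih =>
    have hiff : ∀ s, (PetalsHit e τ J s ∧ ∀ a ∈ insert g G, Hits a s) ↔
        (PetalsHit e τ J s ∧ ∀ a ∈ G, Hits a s) ∧ Hits g s := fun s => by
      rw [Finset.forall_mem_insert]; tauto
    rw [Finset.card_insert_of_notMem hg]
    rcases ih with ih | ⟨τ', J', h', hJ', hle, hJG⟩
    · left
      rw [signProb_congr hiff]
      exact (signProb_mono fun s hs => hs.1).trans ih
    · have hiff' : ∀ s, (PetalsHit e τ J s ∧ ∀ a ∈ insert g G, Hits a s) ↔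
          PetalsHit e τ' J' s ∧ Hits g s := fun s => by rw [hiff, hJG]
      rw [signProb_congr hiff']
      have same : (∀ s, PetalsHit e τ' J' s → Hits g s) →
          ∃ τ'' J'', IsSunflower e τ'' p q J'' ∧ 2 ≤ J''.card ∧ J''.card ≤ J.card + (G.card + 1) ∧
            ∀ s, PetalsHit e τ'' J'' s ↔ PetalsHit e τ J s ∧ ∀ a ∈ insert g G, Hits a s :=
        fun hs => ⟨τ', J', h', hJ', by omega, fun s => by
          rw [hiff']; exact ⟨fun h1 => ⟨h1, hs s h1⟩, fun h1 => h1.1⟩⟩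
      by_cases hc : IsCoordinate (eliminate e q g)
      · rcases h'.cases_of_isCoordinate_eliminate hc with h1 | ⟨j, hj, h1⟩ | h1 | h1
        · exact Or.inr (same fun s _ => h1.hits s)
        · refine Or.inr (same fun s hs => ?_)
          rcases h1 with rfl | rfl
          · exact hs j hj
          · exact (hits_neg _ s).2 (hs j hj)
        · exact Or.inl h1
        · obtain ⟨τ'', j, hj, h2, h3⟩ := h1
          have hcard := Finset.card_insert_of_notMem hj
          exact Or.inr ⟨τ'', _, h2, by omega, by omega, fun s => by rw [h3, hiff']⟩
      · exact Or.inl (h'.signProb_petalsHit_and_hits_le hJ' hc)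

/-- The possible large probabilities for families of at most `c` functionals on `d` signs. -/
def IsLargeProb (c d : ℕ) (x : ℝ) : Prop :=
  x = 1 ∨ (1 ≤ c ∧ (x = 3 / 4 ∨ x = 5 / 8 ∨ x = 35 / 64)) ∨ (2 ≤ c ∧ x = 9 / 16) ∨
    ∃ i, 2 ≤ i ∧ i ≤ c ∧ i + 2 ≤ d ∧ x = 1 / 2 + 1 / 2 ^ (i + 1)

theorem isLargeProb_of_sunflower {F : Finset (ι → ℝ)} {f g : ι → ℝ} (hf : f ∈ F) (hg : g ∈ F)
    (hfg : g ≠ f) (h : IsSunflower e τ p q J) (hJ : J.card = 2)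
    (hiff : ∀ s, PetalsHit e τ J s ↔ Hits f s ∧ Hits g s) :
    signProb (fun s => ∀ a ∈ F, Hits a s) ≤ 1 / 2 ∨
      IsLargeProb F.card (Fintype.card ι) (signProb fun s => ∀ a ∈ F, Hits a s) := by
  classical
  have hF : insert f (insert g ((F.erase f).erase g)) = F := by
    rw [Finset.insert_erase (Finset.mem_erase.2 ⟨hfg, hg⟩), Finset.insert_erase hf]
  have hFs : ∀ s, (∀ a ∈ F, Hits a s) ↔
      PetalsHit e τ J s ∧ ∀ a ∈ (F.erase f).erase g, Hits a s := fun s => by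
    conv_lhs => rw [← hF]
    rw [Finset.forall_mem_insert, Finset.forall_mem_insert, hiff, and_assoc]
  have hcard : ((F.erase f).erase g).card + 2 = F.card := by
    have h1 := Finset.card_erase_add_one (Finset.mem_erase.2 ⟨hfg, hg⟩)
    have h2 := Finset.card_erase_add_one hf
    omega
  rcases h.extend (by omega) ((F.erase f).erase g) with h1 | ⟨τ', J', h1, h2, h3, h4⟩
  · left; rwa [signProb_congr hFs]
  · refine Or.inr (Or.inr (Or.inr (Or.inr ⟨J'.card, h2, by omega, h1.card_add_two_le, ?_⟩)))
    rw [← h1.signProb_petalsHit]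
    exact signProb_congr fun s => by rw [hFs, h4]

theorem isLargeProb_of_card_eq_three {F : Finset (ι → ℝ)} {f g : ι → ℝ} {T : Finset ι}
    (hf : f ∈ F) (hg : g ∈ F) (hT : IsSigned f T) (hT3 : T.card = 3) (hgc : ¬ IsCoordinate g)
    (h1 : g ≠ f) (h2 : g ≠ -f) :
    signProb (fun s => ∀ a ∈ F, Hits a s) ≤ 1 / 2 ∨
      IsLargeProb F.card (Fintype.card ι) (signProb fun s => ∀ a ∈ F, Hits a s) := by
  rcases hT.cases_of_card_eq_three hT3 hgc h1 h2 with h | ⟨e, τ, p, q, J, hs, hJ, hiff⟩ |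
    ⟨p, q, j, hs⟩
  · exact Or.inl ((signProb_mono fun s hs => ⟨hs f hf, hs g hg⟩).trans h)
  · exact isLargeProb_of_sunflower hf hg h1 hs hJ hiff
  by_cases hrest : ∀ h ∈ F, IsCoordinate h ∨ h = f ∨ h = -f ∨ h = g ∨ h = -g
  · refine Or.inr (Or.inr (Or.inr (Or.inl ⟨?_, ?_⟩)))
    · exact Finset.one_lt_card.2 ⟨g, hg, f, hf, h1⟩
    · rw [← hs.signProb_hits_and_hits]
      refine signProb_congr fun s => ⟨fun h => ⟨h f hf, h g hg⟩, fun h a ha => ?_⟩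
      rcases hrest a ha with h3 | rfl | rfl | rfl | rfl
      · exact h3.hits s
      · exact h.1
      · exact (hits_neg _ s).2 h.1
      · exact h.2
      · exact (hits_neg _ s).2 h.2
  · push Not at hrest
    obtain ⟨h, hh, hc, hf1, hf2, hg1, hg2⟩ := hrest
    have ht := hs.isTriple
    by_cases hce : IsCoordinate (eliminate (pairPart f p q) q h)
    · rcases ht.isSunflower.cases_of_isCoordinate_eliminate hce with h3 | ⟨i, hi, h3⟩ | h3 | h3
      · exact absurd h3 hc
      · rw [Finset.mem_singleton.1 hi, ← ht.eq_add] at h3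
        exact absurd h3 (not_or.2 ⟨hf1, hf2⟩)
      · simp only [ht.petalsHit_iff] at h3
        exact Or.inl ((signProb_mono fun s hs => ⟨hs f hf, hs h hh⟩).trans h3)
      -- Now `f` and `h` form a sunflower with two petals, and the argument restarts from this pair
      -- instead of `f`, `g`.
      · obtain ⟨τ', i, hi, hs', hiff⟩ := h3
        refine isLargeProb_of_sunflower hf hh hf1 hs' ?_
          fun s => by rw [hiff, ht.petalsHit_iff]
        rw [Finset.card_insert_of_notMem hi, Finset.card_singleton]
    · exact Or.inl ((signProb_mono fun s hs => ⟨hs f hf, hs g hg, hs h hh⟩).trans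
        (hs.signProb_le hce hg1 hg2))

/-- The classification of the large probabilities. -/
theorem signProb_forall_hits_le_or_isLargeProb (F : Finset (ι → ℝ)) :
    signProb (fun s => ∀ a ∈ F, Hits a s) ≤ 1 / 2 ∨
      IsLargeProb F.card (Fintype.card ι) (signProb fun s => ∀ a ∈ F, Hits a s) := by
  by_cases hlarge : signProb (fun s => ∀ a ∈ F, Hits a s) ≤ 1 / 2
  · exact Or.inl hlarge
  have hsigned : ∀ a ∈ F, ¬ IsCoordinate a →
      ∃ T, IsSigned a T ∧ (T.card = 3 ∨ T.card = 5 ∨ T.card = 7) := by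
    intro a ha hac
    obtain ⟨T, hT, h1 | h1⟩ := exists_isSigned_of_half_lt (a := a)
      ((not_le.1 hlarge).trans_le (signProb_mono fun s hs => hs a ha))
    · exact absurd (hT.isCoordinate h1) hac
    · exact ⟨T, hT, h1⟩
  by_cases h0 : ∀ a ∈ F, IsCoordinate a
  · exact Or.inr (Or.inl (signProb_of_forall fun s a ha => (h0 a ha).hits s))
  push Not at h0
  obtain ⟨f, hf, hfc⟩ := h0
  obtain ⟨T, hT, hTc⟩ := hsigned f hf hfc
  by_cases h1 : ∀ g ∈ F, IsCoordinate g ∨ g = f ∨ g = -f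
  · refine Or.inr (Or.inr (Or.inl ⟨Finset.card_pos.2 ⟨f, hf⟩, ?_⟩))
    have : signProb (fun s => ∀ a ∈ F, Hits a s) = signProb (Hits f) := by
      refine signProb_congr fun s => ⟨fun h => h f hf, fun h a ha => ?_⟩
      rcases h1 a ha with h3 | rfl | rfl
      · exact h3.hits s
      · exact h
      · exact (hits_neg _ s).2 h
    rw [this]
    rcases hTc with h | h | h
    · exact Or.inl (hT.signProb_hits_three h)
    · exact Or.inr (Or.inl (hT.signProb_hits_five h))
    · exact Or.inr (Or.inr (hT.signProb_hits_seven h))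
  push Not at h1
  obtain ⟨g, hg, hgc, hgf, hgf'⟩ := h1
  obtain ⟨S, hS, hSc⟩ := hsigned g hg hgc
  rcases hTc with h | h
  · exact isLargeProb_of_card_eq_three hf hg hT h hgc hgf hgf'
  have hfg' : f ≠ -g := fun h => hgf' (by rw [h, neg_neg])
  rcases hSc with h' | h'
  · exact isLargeProb_of_card_eq_three hg hf hS h' hfc hgf.symm hfg'
  · exact Or.inl ((signProb_mono fun s hs => ⟨hs f hf, hs g hg⟩).trans
      (signProb_hits_and_hits_le_of_card hT hS h h' hgf.symm hfg'))

end Families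

/-! ### From subspaces to sign vectors -/

section Homogenization

variable {κ : Type*} [Fintype κ] [DecidableEq κ]

/-- The functional on `Option κ` which at `(1, 2 x - 1)` takes the value `2 a x - 1`. -/
def homogenize (a : κ → ℝ) : Option κ → ℝ
  | some i => a i
  | none => ∑ i, a i - 1

/-- The vertex of the cube that corresponds to a sign vector. -/
noncomputable def cubeVertex (z : κ → ℤˣ) : κ → ℝ := fun i => (1 + signVal (z i)) / 2

theorem signVal_injective : Function.Injective signVal := by
  intro u v h
  exact Units.ext (Int.cast_injective (α := ℝ) h)

theorem cubeVertex_injective : Function.Injective (cubeVertex (κ := κ)) := by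
  intro z w h
  funext i
  have := congrFun h i
  simp only [cubeVertex] at this
  exact signVal_injective (by linarith)

theorem exists_cubeVertex_eq {y : κ → ℝ} (hy : ∀ i, y i = 0 ∨ y i = 1) :
    ∃ z, cubeVertex z = y := by
  refine ⟨fun i => if y i = 1 then 1 else -1, funext fun i => ?_⟩
  rcases hy i with h | h <;> simp [cubeVertex, h, signVal]

theorem signDot_homogenize (a : κ → ℝ) (s : Option κ → ℤˣ) :
    signDot (homogenize a) s =
      (∑ i, a i - 1) * signVal (s none) + ∑ i, a i * signVal (s (some i)) := by
  rw [signDot, Fintype.sum_option]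
  rfl

theorem hits_homogenize_neg (a : κ → ℝ) (s : Option κ → ℤˣ) :
    Hits (homogenize a) (-s) ↔ Hits (homogenize a) s := by
  have : signDot (homogenize a) (-s) = -signDot (homogenize a) s := by
    simp [signDot, signVal_neg]
  rw [Hits, Hits, this, abs_neg]

/-- The sign vector on `Option κ` with the entry `1` at `none`. -/
def extendOne (z : κ → ℤˣ) : Option κ → ℤˣ
  | some i => z i
  | none => 1

theorem hits_homogenize_extendOne (a : κ → ℝ) (z : κ → ℤˣ) :
    Hits (homogenize a) (extendOne z) ↔
      (∑ i, a i * cubeVertex z i = 0 ∨ ∑ i, a i * cubeVertex z i = 1) := by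
  have h : signDot (homogenize a) (extendOne z) = 2 * (∑ i, a i * cubeVertex z i) - 1 := by
    rw [signDot_homogenize, Finset.mul_sum]
    have : ∀ i, 2 * (a i * cubeVertex z i) = a i + a i * signVal (z i) := fun i => by
      simp only [cubeVertex]; ring
    simp only [this, Finset.sum_add_distrib, extendOne, signVal]
    simp
    ring
  rw [Hits, h, abs_eq zero_le_one]
  constructor
  · rintro (h | h)
    · right; linarith
    · left; linarith
  · rintro (h | h) <;> rw [h] <;> norm_num

/-- For an event invariant under global negation, fixing the homogenizing sign to be `1` does not
change the probability. -/
theorem two_pow_mul_signProb {Q : (Option κ → ℤˣ) → Prop} (hQ : ∀ s, Q (-s) ↔ Q s) :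
    2 ^ Fintype.card κ * signProb Q = ({z : κ → ℤˣ | Q (extendOne z)}.ncard : ℝ) := by
  classical
  have hsum : ∑ s : Option κ → ℤˣ, (if Q s then (1 : ℝ) else 0) =
      2 * ∑ z : κ → ℤˣ, if Q (extendOne z) then (1 : ℝ) else 0 := by
    rw [← Equiv.sum_comp (Equiv.piOptionEquivProd (β := fun _ : Option κ => ℤˣ)).symm,
      Fintype.sum_prod_type]
    have huniv : (Finset.univ : Finset ℤˣ) = {1, -1} := by decide
    rw [huniv, Finset.sum_pair (by decide), two_mul]
    have e1 : ∀ z : κ → ℤˣ, (Equiv.piOptionEquivProd (β := fun _ : Option κ => ℤˣ)).symm (1, z) =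
        extendOne z := by
      intro z; funext o; cases o <;> rfl
    have e2 : ∀ z : κ → ℤˣ, (Equiv.piOptionEquivProd (β := fun _ : Option κ => ℤˣ)).symm (-1, z) =
        -extendOne (-z) := by
      intro z; funext o; cases o
      · rfl
      · simp [extendOne, Equiv.piOptionEquivProd]
    congr 1
    · simp only [e1]
    · simp only [e2, hQ]
      exact Equiv.sum_comp (Equiv.neg (κ → ℤˣ)) fun z => if Q (extendOne z) then (1 : ℝ) else 0
  have hcard : ({z : κ → ℤˣ | Q (extendOne z)}.ncard : ℝ) =
      ∑ z : κ → ℤˣ, if Q (extendOne z) then (1 : ℝ) else 0 := by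
    rw [Set.ncard_eq_toFinset_card', Finset.sum_boole]
    congr 2
    ext z; simp
  rw [hcard, signProb, Fintype.card_option, pow_succ]
  rw [show (∑ s : Option κ → ℤˣ, @ite ℝ (Q s) (Classical.propDecidable _) 1 0) =
    ∑ s : Option κ → ℤˣ, (if Q s then (1 : ℝ) else 0) from
    Finset.sum_congr rfl fun s _ => by congr]
  rw [hsum]
  field_simp

/-- The number of vertices in a subspace that is parametrized by some of its coordinates. -/
theorem ncard_inter_hypercube {n : ℕ} (S : Submodule ℝ (Fin n → ℝ)) (ψ : κ → Fin n)
    (c : Fin n → κ → ℝ) (hψ : ∀ i, c (ψ i) = Pi.single i 1)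
    (hS : ∀ x, x ∈ S ↔ ∃ y : κ → ℝ, ∀ m, x m = ∑ i, c m i * y i) :
    (((S : Set (Fin n → ℝ)) ∩ hypercube n).ncard : ℝ) =
      2 ^ Fintype.card κ * signProb (fun s => ∀ m, Hits (homogenize (c m)) s) := by
  have hψ' : ∀ (y : κ → ℝ) i, ∑ j, c (ψ i) j * y j = y i := by
    intro y i
    rw [hψ, Finset.sum_eq_single i]
    · simp
    · intro j _ hj; simp [hj]
    · simp
  rw [two_pow_mul_signProb (fun s => forall_congr' fun m => hits_homogenize_neg _ s)]
  have hinj : Function.Injective fun (z : κ → ℤˣ) (m : Fin n) => ∑ i, c m i * cubeVertex z i := by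
    intro z w h
    refine cubeVertex_injective (funext fun i => ?_)
    rw [← hψ' (cubeVertex z) i, ← hψ' (cubeVertex w) i]
    exact congrFun h (ψ i)
  rw [← Set.ncard_image_of_injective _ hinj]
  congr 2
  ext x
  simp only [Set.mem_inter_iff, SetLike.mem_coe, hypercube, Set.mem_ofPred_eq, Set.mem_image, hS,
    hits_homogenize_extendOne]
  constructor
  · rintro ⟨⟨y, hy⟩, hx⟩
    obtain ⟨z, rfl⟩ := exists_cubeVertex_eq (y := y) fun i => by
      rw [← hψ' y i, ← hy]; exact hx _
    exact ⟨z, fun m => by rw [← hy]; exact hx m, funext fun m => (hy m).symm⟩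
  · rintro ⟨z, hz, rfl⟩
    exact ⟨⟨cubeVertex z, fun m => rfl⟩, hz⟩

theorem isCoordinate_homogenize_single (i : κ) :
    IsCoordinate (homogenize (Pi.single i (1 : ℝ))) := by
  refine ⟨some i, fun o ho => ?_, fun o ho => ?_⟩
  · rw [Finset.mem_singleton.1 ho]; simp [homogenize]
  · cases o with
    | none => simp [homogenize]
    | some j =>
      have : j ≠ i := fun h => ho (by rw [h]; simp)
      simp [homogenize, this]

/-- Every subspace is parametrized by some of its coordinates. -/
theorem exists_parametrization {n : ℕ} (S : Submodule ℝ (Fin n → ℝ)) :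
    ∃ (κ : Type) (_ : Fintype κ) (_ : DecidableEq κ) (ψ : κ → Fin n) (c : Fin n → κ → ℝ),
      Function.Injective ψ ∧ Fintype.card κ = Module.finrank ℝ S ∧
      (∀ i, c (ψ i) = Pi.single i 1) ∧
      ∀ x, x ∈ S ↔ ∃ y : κ → ℝ, ∀ m, x m = ∑ i, c m i * y i := by
  classical
  let v : Fin n → Module.Dual ℝ S := fun m => (LinearMap.proj m).comp S.subtype
  -- A maximal linearly independent subfamily of the coordinate functionals restricted to `S` serves
  -- as a coordinate system.
  obtain ⟨κ, ψ, hinj, hspan, hli⟩ := exists_linearIndependent' ℝ v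
  have : Finite κ := Finite.of_injective ψ hinj
  let _ : Fintype κ := Fintype.ofFinite κ
  have hmem : ∀ m, ∃ c : κ → ℝ, ∑ i, c i • v (ψ i) = v m := by
    intro m
    have : v m ∈ Submodule.span ℝ (Set.range (v ∘ ψ)) := by
      rw [hspan]; exact Submodule.subset_span ⟨m, rfl⟩
    exact (Submodule.mem_span_range_iff_exists_fun ℝ).1 this
  choose c hc using hmem
  have hc' : ∀ (x : S) m, (x : Fin n → ℝ) m = ∑ i, c m i * (x : Fin n → ℝ) (ψ i) := by
    intro x m
    have := congrArg (fun l : Module.Dual ℝ S => l x) (hc m)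
    simpa [v] using this.symm
  let R : S →ₗ[ℝ] (κ → ℝ) := LinearMap.pi fun i => v (ψ i)
  have hR : ∀ x i, R x i = (x : Fin n → ℝ) (ψ i) := fun x i => rfl
  have hRinj : Function.Injective R := by
    intro x y h
    ext m
    rw [hc' x m, hc' y m]
    refine Finset.sum_congr rfl fun i _ => ?_
    rw [← hR, ← hR, h]
  have hcard : Fintype.card κ = Module.finrank ℝ S := by
    apply le_antisymm
    · have := hli.fintype_card_le_finrank
      rwa [Subspace.dual_finrank_eq] at this
    · simpa using LinearMap.finrank_le_finrank_of_injective hRinj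
  have hRsurj : Function.Surjective R :=
    (LinearMap.injective_iff_surjective_of_finrank_eq_finrank (by simp [hcard])).1 hRinj
  refine ⟨κ, inferInstance, inferInstance, ψ, c, hinj, hcard, fun i => funext fun l => ?_,
    fun x => ⟨fun hx => ⟨R ⟨x, hx⟩, fun m => hc' ⟨x, hx⟩ m⟩, ?_⟩⟩
  · obtain ⟨x, hx⟩ := hRsurj (Pi.single l 1)
    have h1 := hc' x (ψ i)
    simp only [← hR, hx] at h1
    rw [Finset.sum_eq_single l (fun j _ hj => by simp [hj]) (by simp)] at h1
    simp only [Pi.single_eq_same, mul_one] at h1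
    rw [← h1, Pi.single_comm]
  · rintro ⟨y, hy⟩
    obtain ⟨x, rfl⟩ := hRsurj y
    convert x.2
    funext m
    rw [hy m, hc' x m]
    rfl

theorem isLargeProb_mono {c c' d : ℕ} (h : c ≤ c') {x : ℝ} (hx : IsLargeProb c d x) :
    IsLargeProb c' d x := by
  rcases hx with h1 | ⟨h1, h2⟩ | ⟨h1, h2⟩ | ⟨i, h1, h2, h3⟩
  · exact Or.inl h1
  · exact Or.inr (Or.inl ⟨h1.trans h, h2⟩)
  · exact Or.inr (Or.inr (Or.inl ⟨h1.trans h, h2⟩))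
  · exact Or.inr (Or.inr (Or.inr ⟨i, h1, h2.trans h, h3⟩))

theorem exists_isLargeProb_of_mem {k c t : ℕ} (ht : t ∈ largeIntersectionSizes (k + c) k)
    (hk : 1 ≤ k) : ∃ x, IsLargeProb c (k + 1) x ∧ (t : ℝ) = 2 ^ k * x := by
  classical
  obtain ⟨⟨S, hS, rfl⟩, hnot⟩ := ht
  obtain ⟨κ, _, _, ψ, a, hinj, hcard, hψ, hmem⟩ := exists_parametrization S
  have hcount := ncard_inter_hypercube S ψ a hψ hmem
  rw [hcard, hS] at hcount
  -- Only the `c` coordinates outside the parametrizing ones matter: the latter homogenize to single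
  -- signs, which always hit.
  set F : Finset (Option κ → ℝ) :=
    (Finset.univ \ Finset.univ.image ψ).image fun m => homogenize (a m) with hF
  have hFc : F.card ≤ c := by
    refine Finset.card_image_le.trans ?_
    rw [Finset.card_sdiff_of_subset (Finset.subset_univ _), Finset.card_image_of_injective _ hinj,
      Finset.card_univ, Finset.card_univ, Fintype.card_fin, hcard, hS]
    omega
  have hev : ∀ s, (∀ m, Hits (homogenize (a m)) s) ↔ ∀ b ∈ F, Hits b s := by
    intro s
    rw [hF, Finset.forall_mem_image]
    refine ⟨fun h m _ => h m, fun h m => ?_⟩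
    by_cases hm : m ∈ Finset.univ.image ψ
    · obtain ⟨i, -, rfl⟩ := Finset.mem_image.1 hm
      rw [hψ]
      exact (isCoordinate_homogenize_single i).hits s
    · exact h (by simpa using hm)
  rw [signProb_congr hev] at hcount
  refine ⟨_, ?_, hcount⟩
  have hd : Fintype.card (Option κ) = k + 1 := by rw [Fintype.card_option, hcard, hS]
  rcases signProb_forall_hits_le_or_isLargeProb F with h | h
  · exfalso
    apply hnot
    constructor
    -- The zero vector is a cube vertex, so the size is at least 1 and a small size does lie in the
    -- excluded interval.
    · rw [Nat.succ_le_iff, Set.ncard_pos ?_]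
      · exact ⟨0, S.zero_mem, fun i => Or.inl rfl⟩
      · refine Set.Finite.inter_of_right ?_ _
        refine (Set.finite_range (cubeVertex (κ := Fin (k + c)))).subset fun x hx => ?_
        exact exists_cubeVertex_eq hx
    · have h2 : (2 : ℝ) ^ k = 2 * 2 ^ (k - 1) := by rw [← pow_succ', Nat.sub_add_cancel hk]
      have h3 : (2 : ℝ) ^ k * signProb (fun s => ∀ b ∈ F, Hits b s) ≤ 2 ^ (k - 1) := by
        rw [h2]
        have : (0 : ℝ) < 2 ^ (k - 1) := by positivity
        nlinarith
      rw [← hcount] at h3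
      exact_mod_cast h3
  · rw [hd] at h
    exact isLargeProb_mono hFc h

/-- Families of functionals give intersection sizes. -/
theorem mem_intersectionSizes {k c t : ℕ} (a : Fin c → Fin k → ℝ)
    (ht : (t : ℝ) = 2 ^ k * signProb (fun s => ∀ m, Hits (homogenize (a m)) s)) :
    t ∈ intersectionSizes (k + c) k := by
  let b : Fin (k + c) → Fin k → ℝ := Fin.addCases (fun i => Pi.single i 1) a
  have hb1 : ∀ i, b (Fin.castAdd c i) = Pi.single i 1 := fun i => by simp [b]
  have hb2 : ∀ m, b (Fin.natAdd k m) = a m := fun m => by simp [b]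
  let L : (Fin k → ℝ) →ₗ[ℝ] (Fin (k + c) → ℝ) := Matrix.mulVecLin (Matrix.of b)
  have hL : ∀ y m, L y m = ∑ i, b m i * y i := fun y m => rfl
  have hinj : Function.Injective L := by
    intro y z h
    funext i
    have := congrFun h (Fin.castAdd c i)
    rw [hL, hL, hb1, Finset.sum_eq_single i (fun j _ hj => by simp [hj]) (by simp),
      Finset.sum_eq_single i (fun j _ hj => by simp [hj]) (by simp)] at this
    simpa using this
  refine ⟨LinearMap.range L, by rw [LinearMap.finrank_range_of_inj hinj]; simp, ?_⟩
  have hcount := ncard_inter_hypercube (LinearMap.range L) (Fin.castAdd c) b hb1 fun x => by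
    rw [LinearMap.mem_range]
    refine exists_congr fun y => ?_
    rw [funext_iff]
    exact forall_congr' fun m => by rw [hL, eq_comm]
  have hev : ∀ s, (∀ m, Hits (homogenize (b m)) s) ↔ ∀ m, Hits (homogenize (a m)) s := by
    intro s
    refine ⟨fun h m => by rw [← hb2]; exact h _, fun h m => ?_⟩
    refine Fin.addCases (fun i => ?_) (fun i => ?_) m
    · rw [hb1]; exact (isCoordinate_homogenize_single i).hits s
    · rw [hb2]; exact h i
  rw [signProb_congr hev, Fintype.card_fin, ← ht] at hcount
  exact_mod_cast hcount.symm

end Homogenization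

/-! ### Realization of the large sizes -/

section Realization

variable {κ : Type*} [Fintype κ] [DecidableEq κ]

/-- The functional with coefficient `1` on `P` and `-1` on `N`. -/
def signedIndicator (P N : Finset κ) : κ → ℝ :=
  fun i => (if i ∈ P then 1 else 0) - if i ∈ N then 1 else 0

theorem homogenize_signedIndicator_none (P N : Finset κ) :
    homogenize (signedIndicator P N) none = (P.card : ℝ) - N.card - 1 := by
  simp [homogenize, signedIndicator, Finset.sum_sub_distrib]

theorem abs_signedIndicator {P N : Finset κ} (h : Disjoint P N) {i : κ} (hi : i ∈ P ∪ N) :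
    |signedIndicator P N i| = 1 := by
  rw [signedIndicator]
  rcases Finset.mem_union.1 hi with h1 | h1
  · rw [if_pos h1, if_neg (Finset.disjoint_left.1 h h1)]; norm_num
  · rw [if_pos h1, if_neg (Finset.disjoint_right.1 h h1)]; norm_num

theorem signedIndicator_of_notMem {P N : Finset κ} {i : κ} (hi : i ∉ P ∪ N) :
    signedIndicator P N i = 0 := by
  rw [Finset.mem_union, not_or] at hi
  rw [signedIndicator, if_neg hi.1, if_neg hi.2, sub_zero]

/-- The coefficients sum to 2, so the homogenizing sign gets coefficient 1; with coefficient sum 1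
it would drop out. -/
theorem isSigned_homogenize_insertNone {P N : Finset κ} (h : Disjoint P N)
    (hc : P.card = N.card + 2) :
    IsSigned (homogenize (signedIndicator P N)) (Finset.insertNone (P ∪ N)) := by
  refine ⟨fun o ho => ?_, fun o ho => ?_⟩
  · cases o with
    | none => rw [homogenize_signedIndicator_none, hc]; push_cast; norm_num
    | some i => exact abs_signedIndicator h (Finset.some_mem_insertNone.1 ho)
  · cases o with
    | none => exact absurd Finset.none_mem_insertNone ho
    | some i => exact signedIndicator_of_notMem fun hi => ho (Finset.some_mem_insertNone.2 hi)

theorem isSigned_homogenize_map_some {P N : Finset κ} (h : Disjoint P N)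
    (hc : P.card = N.card + 1) :
    IsSigned (homogenize (signedIndicator P N)) ((P ∪ N).map Function.Embedding.some) := by
  refine ⟨fun o ho => ?_, fun o ho => ?_⟩
  · obtain ⟨i, hi, rfl⟩ := Finset.mem_map.1 ho
    exact abs_signedIndicator h hi
  · cases o with
    | none => rw [homogenize_signedIndicator_none, hc]; push_cast; ring
    | some i => exact signedIndicator_of_notMem fun hi => ho (Finset.mem_map.2 ⟨i, hi, rfl⟩)

theorem exists_isSigned_homogenize {r : ℕ} (hr : 2 * r + 2 ≤ Fintype.card κ) :
    ∃ (a : κ → ℝ) (T : Finset (Option κ)), IsSigned (homogenize a) T ∧ T.card = 2 * r + 3 := by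
  obtain ⟨U, -, hU⟩ := Finset.exists_subset_card_eq (s := (Finset.univ : Finset κ)) hr
  obtain ⟨P, hP, hPc⟩ := Finset.exists_subset_card_eq (s := U) (n := r + 2) (by omega)
  have hNc := Finset.card_sdiff_of_subset hP
  refine ⟨_, _, isSigned_homogenize_insertNone (P := P) (N := U \ P)
    Finset.disjoint_sdiff (by omega), ?_⟩
  rw [Finset.union_sdiff_of_subset hP, Finset.card_insertNone, hU]

/-- Take `y₁ + y₂`, which uses the homogenizing sign, and `y₃ + y₄ - y₅`, which does not. They
homogenize to sums of three signs on disjoint supports, so the probability is `(3/4)^2`. -/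
theorem exists_signProb_eq_nine_div_sixteen (h : 5 ≤ Fintype.card κ) :
    ∃ a b : κ → ℝ,
      signProb (fun s => Hits (homogenize a) s ∧ Hits (homogenize b) s) = 9 / 16 := by
  obtain ⟨P, -, hP⟩ := Finset.exists_subset_card_eq (s := (Finset.univ : Finset κ)) (n := 2)
    (by rw [Finset.card_univ]; omega)
  obtain ⟨U, hU, hUc⟩ := Finset.exists_subset_card_eq (s := Pᶜ) (n := 3)
    (by rw [Finset.card_compl]; omega)
  obtain ⟨V, hV, hVc⟩ := Finset.exists_subset_card_eq (s := U) (n := 2) (by omega)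
  obtain ⟨x, y, hxy, rfl⟩ := Finset.card_eq_two.1 hP
  have hNc := Finset.card_sdiff_of_subset hV
  have hf := isSigned_homogenize_insertNone (P := {x, y}) (N := ∅) (by simp) (by simp [hP])
  have hg := isSigned_homogenize_map_some (P := V) (N := U \ V) Finset.disjoint_sdiff (by omega)
  rw [Finset.union_sdiff_of_subset hV] at hg
  have ht : IsTriple (homogenize (signedIndicator {x, y} ∅)) (some x) (some y) none := by
    refine ⟨by simpa using hxy, by simp, by simp, ?_⟩
    convert hf using 1
    ext o; cases o <;> simp
  refine ⟨_, signedIndicator V (U \ V), (ht.signProb_hits_and_hits _).trans ?_⟩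
  have hy : y ∉ U := fun hy => by simpa using hU hy
  have hgy : homogenize (signedIndicator V (U \ V)) (some y) = 0 := hg.2 _ (by simpa using hy)
  have hgn : homogenize (signedIndicator V (U \ V)) none = 0 := hg.2 _ (by simp)
  rw [eliminate, eliminatePair, hgy, hgn]
  simp only [zero_mul, zero_smul, sub_zero]
  rw [hg.signProb_hits_three (by rw [Finset.card_map, hUc])]
  norm_num

theorem homogenize_pair {x y : κ} (hxy : y ≠ x) :
    homogenize (signedIndicator {x, y} ∅) =
      (Pi.single none 1 + Pi.single (some x) 1) + Pi.single (some y) 1 := by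
  funext o
  cases o with
  | none =>
    rw [homogenize_signedIndicator_none, Finset.card_pair hxy.symm]
    have h : ∀ z : κ, (Pi.single (some z) 1 : Option κ → ℝ) none = 0 := fun z =>
      Pi.single_eq_of_ne (Option.some_ne_none z).symm 1
    simp only [Pi.add_apply, Pi.single_eq_same, h]
    norm_num
  | some i =>
    simp only [homogenize, signedIndicator, Finset.mem_insert, Finset.mem_singleton]
    by_cases h1 : i = x
    · subst h1; simp [hxy.symm]
    · by_cases h2 : i = y
      · subst h2; simp [h1]
      · simp [h1, h2]

/-- The functionals `x + y` with `x` fixed share the pair formed by the homogenizing sign and `x`.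
There are `i` choices of `y`, repeated to fill all `c` slots. -/
theorem exists_signProb_eq_sunflower {c i : ℕ} (hi : 1 ≤ i) (hic : i ≤ c)
    (hκ : i + 1 ≤ Fintype.card κ) :
    ∃ a : Fin c → κ → ℝ,
      signProb (fun s => ∀ m, Hits (homogenize (a m)) s) = 1 / 2 + 1 / 2 ^ (i + 1) := by
  obtain ⟨x⟩ : Nonempty κ := Fintype.card_pos_iff.1 (by omega)
  obtain ⟨U, hU, hUc⟩ := Finset.exists_subset_card_eq (s := Finset.univ.erase x) (n := i)
    (by rw [Finset.card_erase_of_mem (Finset.mem_univ x), Finset.card_univ]; omega)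
  have : Nonempty U := by
    rw [Finset.nonempty_coe_sort, ← Finset.card_pos]; omega
  obtain ⟨ρ, hsurj⟩ : ∃ ρ : Fin c → U, Function.Surjective ρ := by
    obtain ⟨φ⟩ : Nonempty (U ↪ Fin c) :=
      Function.Embedding.nonempty_of_card_le (by simpa [hUc] using hic)
    exact ⟨_, Function.invFun_surjective φ.injective⟩
  have hne : ∀ y ∈ U, y ≠ x := fun y hy => Finset.ne_of_mem_erase (hU hy)
  have hsun : IsSunflower (Pi.single none 1 + Pi.single (some x) 1) (fun _ => 1) none (some x)
      (U.map Function.Embedding.some) := by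
    refine ⟨by simp, ⟨fun o ho => ?_, fun o ho => ?_⟩, by simp, ?_, by simp⟩
    · rcases Finset.mem_insert.1 ho with rfl | ho
      · simp
      · rw [Finset.mem_singleton.1 ho]; simp
    · simp only [Finset.mem_insert, Finset.mem_singleton, not_or] at ho
      simp [ho.1, ho.2]
    · simp only [Finset.mem_map, Function.Embedding.some_apply, Option.some.injEq,
        exists_eq_right]
      exact fun hx => hne x hx rfl
  refine ⟨fun m => signedIndicator {x, (ρ m : κ)} ∅, ?_⟩
  have h := hsun.signProb_petalsHit
  rw [Finset.card_map, hUc] at h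
  rw [← h]
  refine signProb_congr fun s => ?_
  have hpetal : ∀ m, Hits (homogenize (signedIndicator {x, (ρ m : κ)} ∅)) s ↔
      Hits ((Pi.single none 1 + Pi.single (some x) 1) +
        Pi.single (some (ρ m : κ)) 1) s := fun m => by
    rw [homogenize_pair (hne _ (ρ m).2)]
  simp only [hpetal, PetalsHit, Finset.mem_map, Function.Embedding.some_apply]
  constructor
  · rintro hs o ⟨y, hy, rfl⟩
    obtain ⟨m, hm⟩ := hsurj ⟨y, hy⟩
    have := hs m
    rwa [hm] at this
  · intro hs m
    exact hs _ ⟨_, (ρ m).2, rfl⟩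

theorem exists_signProb_eq {k c : ℕ} (hk : 6 ≤ k) (hc : 1 ≤ c) {x : ℝ}
    (hx : IsLargeProb c (k + 1) x) :
    ∃ a : Fin c → Fin k → ℝ, signProb (fun s => ∀ m, Hits (homogenize (a m)) s) = x := by
  have : NeZero c := ⟨by omega⟩
  have hconst : ∀ a : Fin k → ℝ, signProb (fun s => ∀ _ : Fin c, Hits (homogenize a) s) =
      signProb (Hits (homogenize a)) := fun a =>
    signProb_congr fun s => ⟨fun h => h 0, fun h _ => h⟩
  rcases hx with rfl | ⟨-, rfl | rfl | rfl⟩ | ⟨h2, rfl⟩ | ⟨i, h2, hic, hik, rfl⟩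
  · exact ⟨fun _ => Pi.single ⟨0, by omega⟩ 1, signProb_of_forall fun s _ =>
      (isCoordinate_homogenize_single _).hits s⟩
  · obtain ⟨a, T, ha, hT⟩ := exists_isSigned_homogenize (κ := Fin k) (r := 0) (by simp; omega)
    exact ⟨fun _ => a, by rw [hconst, ha.signProb_hits_three hT]⟩
  · obtain ⟨a, T, ha, hT⟩ := exists_isSigned_homogenize (κ := Fin k) (r := 1) (by simp; omega)
    exact ⟨fun _ => a, by rw [hconst, ha.signProb_hits_five hT]⟩
  -- Seven signs need six coordinates besides the homogenizing one; this is where `6 ≤ k` is sharp.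
  · obtain ⟨a, T, ha, hT⟩ := exists_isSigned_homogenize (κ := Fin k) (r := 2) (by simp; omega)
    exact ⟨fun _ => a, by rw [hconst, ha.signProb_hits_seven hT]⟩
  · obtain ⟨a, b, hab⟩ := exists_signProb_eq_nine_div_sixteen (κ := Fin k) (by simp; omega)
    refine ⟨fun m => if m = 0 then a else b, ?_⟩
    rw [← hab]
    refine signProb_congr fun s => ⟨fun h => ⟨by simpa using h 0, ?_⟩, fun h m => ?_⟩
    · have h1 := h ⟨1, by omega⟩
      dsimp only at h1
      rwa [if_neg (by simp [Fin.ext_iff])] at h1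
    · dsimp only
      split_ifs
      · exact h.1
      · exact h.2
  · exact exists_signProb_eq_sunflower (by omega) hic (by simp; omega)

end Realization

/-! ### Translation of probabilities into sizes -/

theorem mem_largeIntersectionSizes_iff {k c t : ℕ} (hk : 6 ≤ k) (hc : 1 ≤ c) :
    t ∈ largeIntersectionSizes (k + c) k ↔
      ∃ x, IsLargeProb c (k + 1) x ∧ (t : ℝ) = 2 ^ k * x := by
  refine ⟨fun h => exists_isLargeProb_of_mem h (by omega), ?_⟩
  rintro ⟨x, hx, ht⟩
  have hlt : 1 / 2 < x := by
    rcases hx with rfl | ⟨-, rfl | rfl | rfl⟩ | ⟨-, rfl⟩ | ⟨i, -, -, -, rfl⟩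
    all_goals norm_num
  obtain ⟨a, ha⟩ := exists_signProb_eq hk hc hx
  refine ⟨mem_intersectionSizes a (by rw [ha, ht]), fun hmem => ?_⟩
  have h1 : (t : ℝ) ≤ 2 ^ (k - 1) := by exact_mod_cast hmem.2
  have h2 : (2 : ℝ) ^ k = 2 * 2 ^ (k - 1) := by
    rw [← pow_succ', Nat.sub_add_cancel (by omega)]
  have h3 : (0 : ℝ) < 2 ^ (k - 1) := by positivity
  rw [ht, h2] at h1
  nlinarith

theorem cast_eq_half_add_iff {k i t : ℕ} (h : i + 1 ≤ k) {x : ℝ}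
    (hx : x = 1 / 2 + 1 / 2 ^ (i + 1)) :
    (t : ℝ) = 2 ^ k * x ↔ t = 2 ^ (k - 1) + 2 ^ (k - (i + 1)) := by
  obtain ⟨m, rfl⟩ := Nat.exists_eq_add_of_le h
  have e : (2 : ℝ) ^ (i + 1 + m) * x = ((2 ^ (i + m) + 2 ^ m : ℕ) : ℝ) := by
    rw [hx]; push_cast
    field_simp
    ring
  rw [e, Nat.cast_inj, show i + 1 + m - 1 = i + m by omega, Nat.add_sub_cancel_left]

/-- The values 3/4, 5/8 and 9/16 are `1/2 + 1/2^(i+1)` for `i = 1, 2, 3`. Sunflowers with two or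
three petals therefore repeat known values, and 9/16 is available already for `c = 2` because of the
split pairs; petals give new sizes only from `i = 4` on. -/
theorem mem_largeIntersectionSizes_iff_eq {k c t : ℕ} (hk : 6 ≤ k) (hc : 1 ≤ c) :
    t ∈ largeIntersectionSizes (k + c) k ↔
      (t = 2 ^ (k - 1) + 2 ^ (k - 5) + 2 ^ (k - 6) ∨ t = 2 ^ (k - 1) + 2 ^ (k - 3) ∨
        t = 2 ^ (k - 1) + 2 ^ (k - 2) ∨ t = 2 ^ k) ∨
      (2 ≤ c ∧ t = 2 ^ (k - 1) + 2 ^ (k - 4)) ∨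
      ∃ i, 4 ≤ i ∧ i ≤ c ∧ i ≤ k - 1 ∧ t = 2 ^ (k - 1) + 2 ^ (k - (i + 1)) := by
  rw [mem_largeIntersectionSizes_iff hk hc]
  have e0 : (t : ℝ) = 2 ^ k * 1 ↔ t = 2 ^ k := by
    rw [mul_one]; norm_cast
  have e1 := cast_eq_half_add_iff (k := k) (i := 1) (t := t) (x := 3 / 4) (by omega) (by norm_num)
  have e2 := cast_eq_half_add_iff (k := k) (i := 2) (t := t) (x := 5 / 8) (by omega) (by norm_num)
  have e3 := cast_eq_half_add_iff (k := k) (i := 3) (t := t) (x := 9 / 16) (by omega) (by norm_num)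
  have e4 : (t : ℝ) = 2 ^ k * (35 / 64) ↔ t = 2 ^ (k - 1) + 2 ^ (k - 5) + 2 ^ (k - 6) := by
    obtain ⟨m, rfl⟩ := Nat.exists_eq_add_of_le hk
    have e : (2 : ℝ) ^ (6 + m) * (35 / 64) = ((2 ^ (5 + m) + 2 ^ (1 + m) + 2 ^ m : ℕ) : ℝ) := by
      push_cast
      rw [pow_add, pow_add, pow_add]
      ring
    rw [e, Nat.cast_inj, show 6 + m - 1 = 5 + m by omega, show 6 + m - 5 = 1 + m by omega,
      Nat.add_sub_cancel_left]
  constructor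
  · rintro ⟨x, rfl | ⟨-, rfl | rfl | rfl⟩ | ⟨h2, rfl⟩ | ⟨i, h2, hic, hik, hx⟩, ht⟩
    · exact Or.inl (Or.inr (Or.inr (Or.inr (e0.1 ht))))
    · exact Or.inl (Or.inr (Or.inr (Or.inl (e1.1 ht))))
    · exact Or.inl (Or.inr (Or.inl (e2.1 ht)))
    · exact Or.inl (Or.inl (e4.1 ht))
    · exact Or.inr (Or.inl ⟨h2, e3.1 ht⟩)
    · rw [cast_eq_half_add_iff (by omega) hx] at ht
      by_cases h4 : 4 ≤ i
      · exact Or.inr (Or.inr ⟨i, h4, hic, by omega, ht⟩)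
      · obtain rfl | rfl : i = 2 ∨ i = 3 := by omega
        · exact Or.inl (Or.inr (Or.inl ht))
        · exact Or.inr (Or.inl ⟨by omega, ht⟩)
  · rintro ((h | h | h | h) | ⟨h2, h⟩ | ⟨i, h4, hic, hik, h⟩)
    · exact ⟨_, Or.inr (Or.inl ⟨hc, Or.inr (Or.inr rfl)⟩), e4.2 h⟩
    · exact ⟨_, Or.inr (Or.inl ⟨hc, Or.inr (Or.inl rfl)⟩), e2.2 h⟩
    · exact ⟨_, Or.inr (Or.inl ⟨hc, Or.inl rfl⟩), e1.2 h⟩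
    · exact ⟨_, Or.inl rfl, e0.2 h⟩
    · exact ⟨_, Or.inr (Or.inr (Or.inl ⟨h2, rfl⟩)), e3.2 h⟩
    · exact ⟨_, Or.inr (Or.inr (Or.inr ⟨i, by omega, hic, by omega, rfl⟩)),
        (cast_eq_half_add_iff (by omega) rfl).2 h⟩

theorem theorem3p2 (k : ℕ) (hk : 6 ≤ k) :
    largeIntersectionSizes (k + 1) k =
      {2 ^ (k - 1) + 2 ^ (k - 5) + 2 ^ (k - 6), 2 ^ (k - 1) + 2 ^ (k - 3),
        2 ^ (k - 1) + 2 ^ (k - 2), 2 ^ k} ∧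
    largeIntersectionSizes (k + 2) k =
      largeIntersectionSizes (k + 1) k ∪ {2 ^ (k - 1) + 2 ^ (k - 4)} ∧
    (∀ i : ℕ, 3 ≤ i → i ≤ k - 1 →
      largeIntersectionSizes (k + i) k =
        largeIntersectionSizes (k + i - 1) k ∪ {2 ^ (k - 1) + 2 ^ (k - (i + 1))}) ∧
    (∀ i : ℕ, k ≤ i →
      largeIntersectionSizes (k + i) k = largeIntersectionSizes (2 * k - 1) k) := by
  refine ⟨?_, ?_, fun i h3 hi => ?_, fun i hi => ?_⟩
  · ext t
    rw [mem_largeIntersectionSizes_iff_eq hk le_rfl]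
    simp only [Set.mem_insert_iff, Set.mem_singleton_iff]
    constructor
    · rintro (h | ⟨h, -⟩ | ⟨i, h4, hi, -⟩)
      · exact h
      · omega
      · omega
    · exact Or.inl
  · ext t
    rw [Set.mem_union, mem_largeIntersectionSizes_iff_eq hk (by norm_num),
      mem_largeIntersectionSizes_iff_eq hk le_rfl, Set.mem_singleton_iff]
    constructor
    · rintro (h | ⟨-, h⟩ | ⟨i, h4, hi, -⟩)
      · exact Or.inl (Or.inl h)
      · exact Or.inr h
      · omega
    · rintro ((h | ⟨h, -⟩ | ⟨i, h4, hi, -⟩) | h)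
      · exact Or.inl h
      · omega
      · omega
      · exact Or.inr (Or.inl ⟨le_rfl, h⟩)
  · ext t
    rw [show k + i - 1 = k + (i - 1) by omega, Set.mem_union,
      mem_largeIntersectionSizes_iff_eq hk (by omega),
      mem_largeIntersectionSizes_iff_eq hk (by omega), Set.mem_singleton_iff]
    constructor
    · rintro (h | ⟨-, h⟩ | ⟨j, h4, hj, hjk, h⟩)
      · exact Or.inl (Or.inl h)
      · exact Or.inl (Or.inr (Or.inl ⟨by omega, h⟩))
      · rcases Nat.lt_or_ge j i with hlt | hge
        · exact Or.inl (Or.inr (Or.inr ⟨j, h4, by omega, hjk, h⟩))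
        · rw [show j = i by omega] at h
          exact Or.inr h
    · rintro ((h | ⟨-, h⟩ | ⟨j, h4, hj, hjk, h⟩) | h)
      · exact Or.inl h
      · exact Or.inr (Or.inl ⟨by omega, h⟩)
      · exact Or.inr (Or.inr ⟨j, h4, by omega, hjk, h⟩)
      -- For `i = 3` the adjoined size is the one already present since codimension 2.
      · rcases Nat.lt_or_ge i 4 with hlt | hge
        · rw [show i = 3 by omega] at h
          exact Or.inr (Or.inl ⟨by omega, h⟩)
        · exact Or.inr (Or.inr ⟨i, hge, le_rfl, hi, h⟩)
  · ext t
    rw [show 2 * k - 1 = k + (k - 1) by omega, mem_largeIntersectionSizes_iff_eq hk (by omega),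
      mem_largeIntersectionSizes_iff_eq hk (by omega)]
    refine or_congr_right (or_congr ?_ (exists_congr fun j => ?_))
    · exact and_congr_left fun _ => ⟨fun _ => by omega, fun _ => by omega⟩
    · exact and_congr_right fun _ => ⟨fun h => ⟨h.2.1, h.2⟩, fun h => ⟨by omega, h.2⟩⟩
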